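/- Let $k$ be a finite field with $q$ elements, $k_1$ its quadratic extension, $\bar c=c^q$ for $c\in k_1$, $K\supseteq k_1$ a field (of constants), $\Omega\supseteq K$ an algebraically closed field, and $n\ge 1$. A Drinfeld module here is a rank-two Drinfeld $k[T]$-module $\phi$ over $\Omega$ with $\gamma(T)=1$, i.e. $\phi_T=1+g\tau+\Delta\tau^2$ with $\Delta\ne0$ ($\tau$ the $q$-Frobenius); it is normalized if $\Delta=-1$, and $J(\phi)=g^{q+1}/\Delta$. A $T^n$-subgroup $G$ of $\phi$ is a $k[T]$-submodule of $\Omega$ (for the $\phi$-action) isomorphic to $k[T]/(T^n)$; an isomorphism $(\phi,G)\to(\psi,H)$ is a $u\in\Omega^*$ with $u\phi_T=\psi_Tu$, $uG=H$. Let ${\dot X}'_0(T^n)$, ${\dot X}_0(T^n)$, $X_0(T^n)$ be the curves over $K$ parametrizing, respectively, triples $(\phi,x_1,G)$ with $\phi$ normalized, $G$ a $T^n$-subgroup and $0\neq x_1\in G$ with $\phi_T(x_1)=0$; pairs $(\phi,G)$ with $\phi$ normalized; and isomorphism classes of pairs $(\phi,G)$. Their function fields are the fields of definition of a generic triple; of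 a generic pair with $\phi$ normalized; and, for $X_0(T^n)$, the field of definition of $G$ over $K(J)$, where $\phi$ is any Drinfeld module with coefficients in $K(J)$ and with invariant $J$ transcendental over $K$. (0) The noncuspidal points of ${\dot X}'_0(T^n)$ over $\Omega$ are the $(x_1,\dots,x_n)\in(\Omega^*)^n$ with $x_{j-1}^{1-q}x_j+x_j^q=x_{j-1}$ $(2\le j\le n)$, such a point corresponding to $\phi_T=t_{x_1}:=1+x_1^{-q}(x_1^{q^2}-x_1)\tau-\tau^2$, the torsion point $x_1$, and $G=\ker(P_{x_n}\circ\cdots\circ P_{x_1})$, $P_x=x^{q-1}-\tau$, with $T^{n-m}G=\ker(P_{x_m}\circ\cdots\circ P_{x_1})$ for $m\le n$; its function field is $K(x_1,\dots,x_n)$, of degree $q^{n-1}$ over $K(x_1)$, where $x_1$ is transcendental over $K$. (1) $k_1^*$ acts on ${\dot X}'_0(T^n)$ (on the points over $\Omega$, and faithfully by $K$-automorphisms of the function field) by $c\cdot(x_1,\dots,x_n)=(cx_1,\bar cx_2,cx_3,\dots,c^{q^{n-1}}x_n)$; multiplication by $c$ is an isomorphism from the pair $(\phi,G)$ of a point to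 the pair of its image. (2) The quotient of ${\dot X}'_0(T^n)$ by $k^*$ is ${\dot X}_0(T^n)$: the map $(x_1,\dots,x_n)\mapsto(\phi,G)$ is surjective onto pairs with $\phi$ normalized and its fibres are the $k^*$-orbits; and $K(x_1,\dots,x_n)^{k^*}$ is the function field of ${\dot X}_0(T^n)$, which is also obtained from $K(x_1,\dots,x_n)^{k_1^*}$ by adjoining the $(q+1)$-st root $g$ of $-J$. (3) The quotient of ${\dot X}'_0(T^n)$ by $k_1^*$ is the Drinfeld modular curve $X_0(T^n)$: every pair is isomorphic to one coming from a point of ${\dot X}'_0(T^n)$, two points give isomorphic pairs if and only if they lie in the same $k_1^*$-orbit, and $K(x_1,\dots,x_n)^{k_1^*}$ is the function field of $X_0(T^n)$. (4) The elements $z_j=x_{j-1}x_j$ $(2\le j\le n)$ satisfy the equations $z_{j+1}^q+z_{j+1}=z_j^q/(z_j^{q-1}+1)$ of the later Garcia–Stichtenoth tower, and for $n\ge2$ the field $K(z_2,\dots,z_n)$, of degree $q^{n-2}$ over $K(z_2)$ with $z_2$ transcendental over $K$, is the fixed field in $K(x_1,\dots,x_n)$ of the subgroup $\{c\in k_1^*: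 c^{q+1}=1\}$. -/

import Mathlib

open Polynomial

namespace DrinfeldTower

noncomputable section

/-- The `q`-power Frobenius `τ` (`q = #k`), as a `k`-linear endomorphism of `Ω`. -/
def tau (k : Type*) [Field k] [Fintype k] (Ω : Type*) [Field Ω] [Algebra k Ω] :
    Module.End k Ω :=
  (FiniteField.frobeniusAlgHom k Ω).toLinearMap

/-- A Drinfeld `k[T]`-module over `Ω` of rank two with `γ(T) = 1`; it is determined by
`φ_T = 1 + g τ + Δ τ²` with `Δ ≠ 0`. -/
@[ext]
structure DrinfeldModule (Ω : Type*) [Field Ω] where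
  g : Ω
  Δ : Ω
  Δ_ne_zero : Δ ≠ 0

/-- The operator `φ_T = 1 + g τ + Δ τ²`; over an infinite field `Ω`, an element of `Ω{τ}` is
determined by the `k`-linear endomorphism of `Ω` it induces. -/
def DrinfeldModule.opT (k : Type*) [Field k] [Fintype k] {Ω : Type*} [Field Ω] [Algebra k Ω]
    (φ : DrinfeldModule Ω) : Module.End k Ω :=
  1 + LinearMap.mulLeft k φ.g * tau k Ω + LinearMap.mulLeft k φ.Δ * tau k Ω ^ 2

/-- The invariant `J(φ) = g^(q+1) / Δ`. -/
def DrinfeldModule.J (k : Type*) [Fintype k] {Ω : Type*} [Field Ω]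
    (φ : DrinfeldModule Ω) : Ω :=
  φ.g ^ (Fintype.card k + 1) / φ.Δ

/-- Normalized modules: `φ_T = 1 + g τ - τ²`. -/
def DrinfeldModule.IsNormalized {Ω : Type*} [Field Ω] (φ : DrinfeldModule Ω) : Prop :=
  φ.Δ = -1

/-- `G` is a torsion subgroup of `φ` of type `Γ₀(Tⁿ)`: it is a `k[T]`-submodule of `Ω` for the
`φ`-action `a ↦ φ_a`, and it is isomorphic to `k[T]/(Tⁿ)` as a `k[T]`-module. -/
def IsLevel (k : Type*) [Field k] [Fintype k] {Ω : Type*} [Field Ω] [Algebra k Ω]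
    (φ : DrinfeldModule Ω) (n : ℕ) (G : Submodule k Ω) : Prop :=
  ∃ M : Submodule k[X] (Module.AEval' (φ.opT k)),
    (∀ y : Ω, Module.AEval'.of (φ.opT k) y ∈ M ↔ y ∈ G) ∧
    Nonempty (M ≃ₗ[k[X]] (k[X] ⧸ Ideal.span {(X : k[X]) ^ n}))

/-- `u ∈ Ωˣ` is an isomorphism from `φ` to `ψ` (that is, `u ∘ φ_T = ψ_T ∘ u`) which carries the
subgroup `G` onto the subgroup `H`. -/
def IsIso (k : Type*) [Field k] [Fintype k] {Ω : Type*} [Field Ω] [Algebra k Ω]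
    (u : Ω) (φ : DrinfeldModule Ω) (G : Submodule k Ω)
    (ψ : DrinfeldModule Ω) (H : Submodule k Ω) : Prop :=
  u ≠ 0 ∧ LinearMap.mulLeft k u * φ.opT k = ψ.opT k * LinearMap.mulLeft k u ∧
    G.map (LinearMap.mulLeft k u) = H

/-- The equations in the coordinates `x₁, …, xₙ` (here numbered from `0`):
`Q_{x_i}(x_{i+1}) = x_i` with `Q_x(X) = x^(1-q) X + X^q`, all coordinates being nonzero. -/
def IsPoint (k : Type*) [Fintype k] {Ω : Type*} [Field Ω] {n : ℕ} (x : Fin n → Ω) : Prop :=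
  (∀ i, x i ≠ 0) ∧
    ∀ i j : Fin n, (i : ℕ) + 1 = j →
      (x i ^ (Fintype.card k - 1))⁻¹ * x j + x j ^ Fintype.card k = x i

/-- The normalized module `t_x = 1 + x^(-q) (x^(q²) - x) τ - τ²` with the `T`-torsion
point `x ≠ 0`. -/
def tMod (k : Type*) [Fintype k] {Ω : Type*} [Field Ω] (x : Ω) : DrinfeldModule Ω where
  g := (x ^ (Fintype.card k ^ 2) - x) / x ^ Fintype.card k
  Δ := -1
  Δ_ne_zero := neg_ne_zero.mpr one_ne_zero

/-- `P_x = x^(q-1) - τ`. -/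
def opP (k : Type*) [Field k] [Fintype k] {Ω : Type*} [Field Ω] [Algebra k Ω] (x : Ω) :
    Module.End k Ω :=
  LinearMap.mulLeft k (x ^ (Fintype.card k - 1)) - tau k Ω

/-- The kernel of `P_{xₙ} ∘ ⋯ ∘ P_{x₂} ∘ P_{x₁}`. -/
def levelGroup (k : Type*) [Field k] [Fintype k] {Ω : Type*} [Field Ω] [Algebra k Ω]
    {n : ℕ} (x : Fin n → Ω) : Submodule k Ω :=
  LinearMap.ker ((List.ofFn fun i => opP k (x i)).reverse.prod)

/-- `c · (x₁, x₂, x₃, …, xₙ) = (c x₁, c^q x₂, c^(q²) x₃, …, c^(q^(n-1)) xₙ)`. -/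
def act (k : Type*) [Fintype k] {k₁ : Type*} [Field k₁] {Ω : Type*} [Field Ω] [Algebra k₁ Ω]
    {n : ℕ} (c : k₁ˣ) (x : Fin n → Ω) : Fin n → Ω :=
  fun i => algebraMap k₁ Ω c ^ (Fintype.card k ^ (i : ℕ)) * x i

/-- The coefficients of the isogeny polynomial `∏_{y ∈ G} (X - y)` with kernel `G`. -/
def isogCoeffs {k : Type*} [Field k] {Ω : Type*} [Field Ω] [Algebra k Ω]
    (G : Submodule k Ω) : Set Ω :=
  Set.range (∏ᶠ y : G, (X - C (y : Ω))).coeff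

/-- The function field over `K` of the curve of triples `(φ, x₁, G)`, `φ` normalized, at a generic
triple: the field of definition of the triple. -/
def fieldX0DotPrime (K : Type*) [Field K] {k : Type*} [Field k] {Ω : Type*} [Field Ω]
    [Algebra k Ω] [Algebra K Ω] (φ : DrinfeldModule Ω) (x₁ : Ω) (G : Submodule k Ω) :
    IntermediateField K Ω :=
  IntermediateField.adjoin K ({φ.g, x₁} ∪ isogCoeffs G)

/-- The function field over `K` of the curve of pairs `(φ, G)`, `φ` normalized, at a generic pair:
the field of definition of `G` over the field `K(g)` of definition of `φ`. -/
def fieldX0Dot (K : Type*) [Field K] {k : Type*} [Field k] {Ω : Type*} [Field Ω]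
    [Algebra k Ω] [Algebra K Ω] (φ : DrinfeldModule Ω) (G : Submodule k Ω) :
    IntermediateField K Ω :=
  IntermediateField.adjoin K ({φ.g} ∪ isogCoeffs G)

/-- The function field over `K` of the curve `X₀`, computed from a pair `(φ, G)` in which `φ` is
defined over `K(J)` with `J = J(φ)` transcendental: the field of definition of `G` over the
function field `K(J)` of the `J`-line `X(1)`. -/
def fieldX0 (K : Type*) [Field K] {k : Type*} [Field k] [Fintype k] {Ω : Type*} [Field Ω]
    [Algebra k Ω] [Algebra K Ω] (φ : DrinfeldModule Ω) (G : Submodule k Ω) :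
    IntermediateField K Ω :=
  IntermediateField.adjoin K ({φ.J k} ∪ isogCoeffs G)

/-- `φ` is a model, defined over `K(J)`, of the generic Drinfeld module: `J = J(φ)` is
transcendental over `K` and `g, Δ ∈ K(J)`. -/
def IsGenericModel (K k : Type*) [Field K] [Fintype k] {Ω : Type*} [Field Ω] [Algebra K Ω]
    (φ : DrinfeldModule Ω) : Prop :=
  Transcendental K (φ.J k) ∧
    φ.g ∈ IntermediateField.adjoin K {φ.J k} ∧ φ.Δ ∈ IntermediateField.adjoin K {φ.J k}

/-- The field generated over `K` by the coordinates. -/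
abbrev coordField (K : Type*) [Field K] {Ω : Type*} [Field Ω] [Algebra K Ω] {n : ℕ}
    (x : Fin n → Ω) : IntermediateField K Ω :=
  IntermediateField.adjoin K (Set.range x)

/-- The elements `z_j = x_{j-1} x_j`, `2 ≤ j ≤ n`. -/
def zSet {Ω : Type*} [Field Ω] {n : ℕ} (x : Fin n → Ω) : Set Ω :=
  {z | ∃ i j : Fin n, (i : ℕ) + 1 = j ∧ z = x i * x j}

/-- The subfield of `Ω` of the elements of `F` that are fixed by the group `H`. -/
def fixedBy {K Ω : Type*} [Field K] [Field Ω] [Algebra K Ω] {F : IntermediateField K Ω}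
    (H : Subgroup (F ≃ₐ[K] F)) : IntermediateField K Ω :=
  IntermediateField.lift (IntermediateField.fixedField H)

end

end DrinfeldTower

/-! The operator `t_x` factors as `Q_x P_x`, where `P_x = x^(q-1) - τ` has kernel the line `kx` and
`Q_x = x^(1-q) + τ`. If `Q_x(y) = x`, then `P_x Q_x` is of the normalized shape and kills `y`; since
one nonzero torsion point determines a normalized module, `P_x Q_x = t_y`. So a point is a chain of
isogenies `P_{x_i} : t_{x_i} → t_{x_{i+1}}` (`opQ_mul_opP`, `opP_mul_opQ`).

Choose `y` with `P_{x_{n-1}} ⋯ P_{x_1} y = x_n`. Each application of `T` strips one factor `P`, so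
`T^(n-1) y = x_1` and `y` generates a copy of `k[T]/(T^n)` inside `ker (P_{x_n} ⋯ P_{x_1})`; that
kernel has at most `q^n` elements, so the two agree. Conversely, a generator `y` of `G` scaled so
that `T^(n-1) y = x_1` forces `x_{m+1} = P_{x_m} ⋯ P_{x_1} T^(n-1-m) y`. Forgetting `x_1` loses a
scalar in `kˣ`. An isomorphism `u` of normalized modules satisfies `u^(q²) = u`, so it lies in `k₁`,
and it acts on points by the twist.

For function fields, let `L` be the coordinate field of a generic point `x`. A `K`-embedding `τ : L
→ Ω` sends `x` to a point `y` and the coefficients of the polynomial with zero set `G_x` to those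
for `G_y`. Hence `τ` fixes a field of definition `F` exactly when `x` and `y` have the same moduli
data, that is, when `y = c · x` for `c` in the relevant group. As `L` is separable over `F`, the
elements fixed by all such `τ` are those of `F` (`fixedBy_eq_of_embFixed`). In the case of `X_0` an
isomorphism `u` onto a model over `K(J)` need not lie in `L`, but `u^(q-1)` does, and the polynomial
of `uG` involves only `u^(q-1)`.

That `c · x` comes from an automorphism of `L` rests on irreducibility. At a pole of `x_1` one has
`v(x_m) = v(x_{m+1})^q`: the pole is totally ramified, every step has degree `q`, and generic points
are conjugate. The same argument gives the degrees for the `z_j`, while `z_j^q + z_j =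
x_{j-1}^(q+1)` yields both their recursion and the norm-one group. -/

open Polynomial

namespace DrinfeldTower

noncomputable section

/-! ### Cyclic `k[T]`-modules killed by a power of `T` -/

section Cyclic

variable {k V : Type*} [Field k] [AddCommGroup V] [Module k V]

/-- The `k[T]`-submodule generated by `y`, for the action of `k[T]` through `T`. -/
def cyclicSpan (T : Module.End k V) (y : V) : Submodule k V :=
  LinearMap.range ((LinearMap.applyₗ y).comp (aeval (R := k) T).toLinearMap)

theorem mem_cyclicSpan {T : Module.End k V} {y z : V} :
    z ∈ cyclicSpan T y ↔ ∃ p : k[X], aeval T p y = z := by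
  simp [cyclicSpan]

theorem pow_mem_cyclicSpan (T : Module.End k V) (y : V) (i : ℕ) :
    (T ^ i) y ∈ cyclicSpan T y :=
  mem_cyclicSpan.2 ⟨X ^ i, by simp⟩

theorem aeval_eq_aeval_self_smul_of (T : Module.End k V) (y : V) (p : k[X]) :
    p • Module.AEval'.of T y = Module.AEval'.of T (aeval T p y) :=
  (Module.AEval.of_aeval_smul (R := k) (a := T) p y).symm

theorem map_pow_cyclicSpan (T : Module.End k V) (y : V) (i : ℕ) :
    (cyclicSpan T y).map (T ^ i) = cyclicSpan T ((T ^ i) y) := by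
  ext z
  simp only [Submodule.mem_map, mem_cyclicSpan]
  have h : ∀ p : k[X], (T ^ i) (aeval T p y) = aeval T p ((T ^ i) y) := fun p => by
    have h1 : T ^ i = aeval T (X ^ i : k[X]) := by simp
    rw [h1, ← Module.End.mul_apply, ← Module.End.mul_apply, ← map_mul, ← map_mul, mul_comm]
  constructor
  · rintro ⟨_, ⟨p, rfl⟩, rfl⟩
    exact ⟨p, (h p).symm⟩
  · rintro ⟨p, rfl⟩
    exact ⟨_, ⟨p, rfl⟩, h p⟩

/-- The annihilator of `y` is principal and contains the prime power `X^(n+1)`, so it is generated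
by some `X^i`; a smaller exponent would kill `T^n y`. -/
theorem ker_toSpanSingleton_of_nilpotent {T : Module.End k V} {y : V} {n : ℕ}
    (h0 : (T ^ (n + 1)) y = 0) (h1 : (T ^ n) y ≠ 0) :
    LinearMap.ker (LinearMap.toSpanSingleton k[X] _ (Module.AEval'.of T y)) =
      Ideal.span {(X : k[X]) ^ (n + 1)} := by
  set I := LinearMap.ker (LinearMap.toSpanSingleton k[X] _ (Module.AEval'.of T y)) with hI
  have hmem : ∀ p : k[X], p ∈ I ↔ aeval T p y = 0 := fun p => by
    rw [hI, LinearMap.mem_ker, LinearMap.toSpanSingleton_apply, aeval_eq_aeval_self_smul_of]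
    exact LinearEquiv.map_eq_zero_iff _
  obtain ⟨d, hd⟩ := (IsPrincipalIdealRing.principal I).principal
  have hd' : I = Ideal.span {d} := hd
  have hdvd : d ∣ X ^ (n + 1) := by
    rw [← Ideal.mem_span_singleton, ← hd', hmem]
    simpa using h0
  obtain ⟨i, hi, hassoc⟩ := (dvd_prime_pow prime_X _).1 hdvd
  rw [hd', Ideal.span_singleton_eq_span_singleton.2 hassoc]
  rcases hi.lt_or_eq with hlt | rfl
  · exfalso
    apply h1
    have : (X : k[X]) ^ n ∈ I := by
      rw [hd', Ideal.span_singleton_eq_span_singleton.2 hassoc, Ideal.mem_span_singleton]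
      exact pow_dvd_pow _ (by omega)
    simpa using (hmem _).1 this
  · rfl

theorem exists_submodule_cyclicSpan {T : Module.End k V} {y : V} {n : ℕ}
    (h0 : (T ^ (n + 1)) y = 0) (h1 : (T ^ n) y ≠ 0) :
    ∃ M : Submodule k[X] (Module.AEval' T),
      (∀ z : V, Module.AEval'.of T z ∈ M ↔ z ∈ cyclicSpan T y) ∧
      Nonempty (M ≃ₗ[k[X]] (k[X] ⧸ Ideal.span {(X : k[X]) ^ (n + 1)})) := by
  refine ⟨LinearMap.range (LinearMap.toSpanSingleton k[X] _ (Module.AEval'.of T y)), fun z => ?_,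
    ⟨(LinearMap.quotKerEquivRange _).symm.trans
      (Submodule.quotEquivOfEq _ _ (ker_toSpanSingleton_of_nilpotent h0 h1))⟩⟩
  rw [LinearMap.mem_range, mem_cyclicSpan]
  refine exists_congr fun p => ?_
  rw [LinearMap.toSpanSingleton_apply, aeval_eq_aeval_self_smul_of]
  exact (Module.AEval'.of T).injective.eq_iff

/-- The generator is the element corresponding to the class of `1`. -/
theorem exists_eq_cyclicSpan {T : Module.End k V} {G : Submodule k V} {n : ℕ}
    (M : Submodule k[X] (Module.AEval' T)) (hM : ∀ z : V, Module.AEval'.of T z ∈ M ↔ z ∈ G)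
    (e : M ≃ₗ[k[X]] (k[X] ⧸ Ideal.span {(X : k[X]) ^ (n + 1)})) :
    ∃ y, (T ^ (n + 1)) y = 0 ∧ (T ^ n) y ≠ 0 ∧ G = cyclicSpan T y := by
  obtain ⟨y, hy⟩ := (Module.AEval'.of T).surjective (e.symm (Submodule.Quotient.mk 1) : M)
  have hp : ∀ p : k[X],
      Module.AEval'.of T (aeval T p y) = (e.symm (Submodule.Quotient.mk p) : M) := by
    intro p
    rw [← aeval_eq_aeval_self_smul_of, hy, ← Submodule.coe_smul, ← map_smul,
      ← Submodule.Quotient.mk_smul, smul_eq_mul, mul_one]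
  have h0 : ∀ p : k[X], aeval T p y = 0 ↔ X ^ (n + 1) ∣ p := by
    intro p
    rw [← LinearEquiv.map_eq_zero_iff (Module.AEval'.of T), hp, ZeroMemClass.coe_eq_zero,
      LinearEquiv.map_eq_zero_iff, Submodule.Quotient.mk_eq_zero, Ideal.mem_span_singleton]
  refine ⟨y, ?_, ?_, ?_⟩
  · simpa using (h0 (X ^ (n + 1))).2 dvd_rfl
  · intro h
    have := (h0 (X ^ n)).1 (by simpa using h)
    rw [pow_dvd_pow_iff X_ne_zero not_isUnit_X] at this
    omega
  · ext z
    rw [← hM, mem_cyclicSpan]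
    constructor
    · intro hz
      obtain ⟨p, hpz⟩ := Submodule.Quotient.mk_surjective _ (e ⟨_, hz⟩)
      refine ⟨p, (Module.AEval'.of T).injective ?_⟩
      rw [hp, hpz, LinearEquiv.symm_apply_apply]
    · rintro ⟨p, rfl⟩
      rw [hp]
      exact Subtype.property _

theorem finrank_cyclicSpan {T : Module.End k V} {y : V} {n : ℕ}
    (h0 : (T ^ (n + 1)) y = 0) (h1 : (T ^ n) y ≠ 0) :
    Module.finrank k (cyclicSpan T y) = n + 1 := by
  obtain ⟨M, hM, ⟨e⟩⟩ := exists_submodule_cyclicSpan h0 h1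
  have e' : cyclicSpan T y ≃ₗ[k] M :=
    ((Module.AEval'.of T).submoduleMap (cyclicSpan T y)).trans
      (LinearEquiv.ofEq _ (M.restrictScalars k) (by
        ext w
        obtain ⟨z, rfl⟩ := (Module.AEval'.of T).surjective w
        rw [Submodule.restrictScalars_mem, hM]
        constructor
        · rintro ⟨z', hz', h⟩
          rwa [← (Module.AEval'.of T).injective h]
        · intro h
          exact ⟨z, h, rfl⟩))
  rw [e'.finrank_eq, (e.restrictScalars k).finrank_eq, finrank_quotient_span_eq_natDegree,
    natDegree_X_pow]

theorem cyclicSpan_le {T : Module.End k V} {y : V} {G : Submodule k V} (hy : y ∈ G)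
    (hG : ∀ z ∈ G, T z ∈ G) : cyclicSpan T y ≤ G := by
  intro z hz
  obtain ⟨p, rfl⟩ := mem_cyclicSpan.1 hz
  have : ∀ i, (T ^ i) y ∈ G := fun i => by
    induction i with
    | zero => simpa using hy
    | succ i ih => rw [pow_succ', Module.End.mul_apply]; exact hG _ ih
  rw [aeval_eq_sum_range, LinearMap.sum_apply]
  exact Submodule.sum_mem _ fun i _ => by
    rw [LinearMap.smul_apply]; exact G.smul_mem _ (this i)

/-- An element of the cyclic module killed by `T` is a multiple of `Tⁿ y`. -/
theorem exists_smul_of_mem_cyclicSpan_of_apply_eq_zero {T : Module.End k V} {y z : V} {n : ℕ}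
    (h0 : (T ^ (n + 1)) y = 0) (h1 : (T ^ n) y ≠ 0) (hz : z ∈ cyclicSpan T y) (hTz : T z = 0) :
    ∃ c : k, z = c • (T ^ n) y := by
  obtain ⟨p, rfl⟩ := mem_cyclicSpan.1 hz
  have hXp : X ^ (n + 1) ∣ X * p := by
    have : X * p ∈ LinearMap.ker (LinearMap.toSpanSingleton k[X] _ (Module.AEval'.of T y)) := by
      rw [LinearMap.mem_ker, LinearMap.toSpanSingleton_apply, aeval_eq_aeval_self_smul_of,
        map_mul, aeval_X, Module.End.mul_apply, hTz, map_zero]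
    rwa [ker_toSpanSingleton_of_nilpotent h0 h1, Ideal.mem_span_singleton] at this
  rw [pow_succ', mul_dvd_mul_iff_left X_ne_zero] at hXp
  obtain ⟨r, rfl⟩ := hXp
  -- With `z = X^n r · y`, only the constant term of `r` matters, because `T^(n+1) y = 0`.
  obtain ⟨s, hs⟩ : X ∣ r - C (r.coeff 0) := by simp [X_dvd_iff]
  refine ⟨r.coeff 0, ?_⟩
  rw [sub_eq_iff_eq_add.1 hs, mul_add, ← mul_assoc, ← pow_succ, mul_comm _ s, map_add,
    LinearMap.add_apply, map_mul, Module.End.mul_apply]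
  simp [h0, mul_comm (X ^ n), Module.algebraMap_end_apply]

end Cyclic

/-! ### Level structures in terms of a generator -/

section Level

variable {k : Type*} [Field k] [Fintype k] {Ω : Type*} [Field Ω] [Algebra k Ω]

theorem isLevel_iff {φ : DrinfeldModule Ω} {n : ℕ} {G : Submodule k Ω} :
    IsLevel k φ (n + 1) G ↔ ∃ y, (φ.opT k ^ (n + 1)) y = 0 ∧ (φ.opT k ^ n) y ≠ 0 ∧
      G = cyclicSpan (φ.opT k) y := by
  constructor
  · rintro ⟨M, hM, ⟨e⟩⟩
    exact exists_eq_cyclicSpan M hM e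
  · rintro ⟨y, h0, h1, rfl⟩
    exact exists_submodule_cyclicSpan h0 h1

end Level

/-! ### The factorization of `t_x` into `Q_x` and `P_x` -/

section Operators

theorem card_sub_add {k : Type*} [Field k] [Fintype k] : Fintype.card k - 1 + 1 = Fintype.card k :=
  Nat.sub_add_cancel Fintype.card_pos

theorem pow_card_eq {k : Type*} [Field k] [Fintype k] {Ω : Type*} [Field Ω] (x : Ω) :
    x ^ Fintype.card k = x ^ (Fintype.card k - 1) * x := by
  rw [← pow_succ, card_sub_add]

variable {k : Type*} [Field k] [Fintype k] {Ω : Type*} [Field Ω] [Algebra k Ω]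

@[simp]
theorem tau_apply (y : Ω) : tau k Ω y = y ^ Fintype.card k := rfl

theorem tau_sq_apply (y : Ω) : (tau k Ω ^ 2) y = y ^ (Fintype.card k ^ 2) := by
  rw [pow_two, Module.End.mul_apply, tau_apply, tau_apply, ← pow_mul, pow_two]

theorem opT_apply (φ : DrinfeldModule Ω) (y : Ω) :
    φ.opT k y = y + φ.g * y ^ Fintype.card k + φ.Δ * y ^ (Fintype.card k ^ 2) := by
  simp [DrinfeldModule.opT, tau_sq_apply]

theorem opP_apply (x y : Ω) :
    opP k x y = x ^ (Fintype.card k - 1) * y - y ^ Fintype.card k := by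
  simp [opP]

variable (k) in
/-- `Q_x = x^(1-q) + τ`. -/
def opQ (x : Ω) : Module.End k Ω :=
  LinearMap.mulLeft k (x ^ (Fintype.card k - 1))⁻¹ + tau k Ω

theorem opQ_apply (x y : Ω) :
    opQ k x y = (x ^ (Fintype.card k - 1))⁻¹ * y + y ^ Fintype.card k := by
  simp [opQ]

theorem sub_pow_card (a b : Ω) :
    (a - b) ^ Fintype.card k = a ^ Fintype.card k - b ^ Fintype.card k :=
  map_sub (tau k Ω) a b

theorem add_pow_card (a b : Ω) :
    (a + b) ^ Fintype.card k = a ^ Fintype.card k + b ^ Fintype.card k :=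
  map_add (tau k Ω) a b

theorem algebraMap_pow_card (c : k) :
    algebraMap k Ω c ^ Fintype.card k = algebraMap k Ω c := by
  rw [← map_pow, FiniteField.pow_card]

/-- `X^q - X` is the product of the `X - c` over `c ∈ k`; evaluate at `w`. It serves for `k₁` as
well as for `k`. -/
theorem exists_algebraMap_eq_of_pow_card {w : Ω} (hw : w ^ Fintype.card k = w) :
    ∃ c : k, algebraMap k Ω c = w := by
  have h : ∏ c : k, (w - algebraMap k Ω c) = 0 := by
    have hq := Fintype.one_lt_card (α := k)
    have hm : (X ^ Fintype.card k - X : k[X]).Monic :=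
      monic_X_pow_sub (by rw [degree_X]; exact_mod_cast hq)
    have h1 := prod_multiset_X_sub_C_of_monic_of_roots_card_eq hm (by
      rw [FiniteField.roots_X_pow_card_sub_X, FiniteField.X_pow_card_sub_X_natDegree_eq _ hq]
      rfl)
    rw [FiniteField.roots_X_pow_card_sub_X] at h1
    have h2 := congrArg (aeval w) h1
    simpa [hw, map_multiset_prod, Multiset.map_map] using h2
  obtain ⟨c, -, hc⟩ := Finset.prod_eq_zero_iff.1 h
  exact ⟨c, (sub_eq_zero.1 hc).symm⟩

theorem opP_self (x : Ω) : opP k x x = 0 := by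
  rw [opP_apply, ← pow_succ, card_sub_add, sub_self]

theorem opQ_mul_opP {x : Ω} (hx : x ≠ 0) : opQ k x * opP k x = (tMod k x).opT k := by
  ext w
  rw [Module.End.mul_apply, opT_apply, opQ_apply, opP_apply, sub_pow_card, mul_pow]
  have h : x ^ (Fintype.card k - 1) ≠ 0 := pow_ne_zero _ hx
  have hq : (x ^ (Fintype.card k - 1)) ^ Fintype.card k * x ^ Fintype.card k =
      x ^ (Fintype.card k ^ 2) := by
    rw [← mul_pow, ← pow_succ, card_sub_add, ← pow_mul, pow_two]
  simp only [tMod]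
  rw [← hq, pow_two, pow_mul w, pow_card_eq (k := k) x]
  field_simp
  ring

/-- The product has the form `1 + a τ - τ²` and kills `y`, because `Q_x` sends `y` to `x ∈ ker P_x`;
this determines `a`. -/
theorem opP_mul_opQ {x y : Ω} (hx : x ≠ 0) (hy : y ≠ 0) (hxy : opQ k x y = x) :
    opP k x * opQ k x = (tMod k y).opT k := by
  have h : x ^ (Fintype.card k - 1) ≠ 0 := pow_ne_zero _ hx
  have key : ∀ w, opP k x (opQ k x w) = w + (x ^ (Fintype.card k - 1) -
      ((x ^ (Fintype.card k - 1))⁻¹) ^ Fintype.card k) * w ^ Fintype.card k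
        - w ^ (Fintype.card k ^ 2) := by
    intro w
    rw [opQ_apply, opP_apply, add_pow_card, mul_pow, pow_two, pow_mul]
    field_simp
    ring
  have h0 := key y
  rw [hxy, opP_self] at h0
  ext w
  rw [Module.End.mul_apply, key, opT_apply]
  simp only [tMod]
  have hy' : y ^ Fintype.card k ≠ 0 := pow_ne_zero _ hy
  have hg : (y ^ (Fintype.card k ^ 2) - y) / y ^ Fintype.card k = x ^ (Fintype.card k - 1) -
      ((x ^ (Fintype.card k - 1))⁻¹) ^ Fintype.card k := by
    rw [div_eq_iff hy']
    linear_combination h0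
  rw [hg]
  ring

/-- `P_x(w) = 0` says that `w / x` is fixed by the `q`-Frobenius. -/
theorem mem_ker_opP {x w : Ω} (hx : x ≠ 0) :
    w ∈ LinearMap.ker (opP k x) ↔ ∃ c : k, w = c • x := by
  rw [LinearMap.mem_ker, opP_apply]
  constructor
  · intro h
    have hw : (w / x) ^ Fintype.card k = w / x := by
      rw [div_pow, pow_card_eq (k := k) x, div_eq_div_iff (mul_ne_zero (pow_ne_zero _ hx) hx) hx]
      linear_combination (-x) * h
    obtain ⟨c, hc⟩ := exists_algebraMap_eq_of_pow_card hw
    exact ⟨c, by rw [Algebra.smul_def, hc, div_mul_cancel₀ _ hx]⟩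
  · rintro ⟨c, rfl⟩
    rw [Algebra.smul_def, mul_pow, algebraMap_pow_card, pow_card_eq (k := k) x]
    ring

end Operators

/-! ### Compositions `P_{x_m} ⋯ P_{x_1}`, their kernels and isogeny polynomials -/

section Sequences

section IsogPoly

/-- The additive polynomial with kernel `u • G`, where `G` is the level group of `(x₁, …, xₘ)`
and `v = u ^ (q - 1)`. -/
def isogPoly {A : Type*} [CommRing A] (q : ℕ) (v : A) (x : ℕ → A) : ℕ → A[X]
  | 0 => X
  | m + 1 => isogPoly q v x m ^ q - C (v ^ q ^ m * x m ^ (q - 1)) * isogPoly q v x m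

theorem isogPoly_map {A B : Type*} [CommRing A] [CommRing B] (f : A →+* B) (q : ℕ) (v : A)
    (x : ℕ → A) (m : ℕ) :
    (isogPoly q v x m).map f = isogPoly q (f v) (fun i => f (x i)) m := by
  induction m with
  | zero => simp [isogPoly]
  | succ m ih => simp [isogPoly, ih]

theorem isogPoly_congr {A : Type*} [CommRing A] (q : ℕ) (v : A) {x y : ℕ → A} {m : ℕ}
    (h : ∀ i < m, x i = y i) : isogPoly q v x m = isogPoly q v y m := by
  induction m with
  | zero => rfl
  | succ m ih =>
    rw [isogPoly, isogPoly, ih fun i hi => h i (by omega), h m (by omega)]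

theorem isogPoly_monic_natDegree {A : Type*} [CommRing A] [Nontrivial A] {q : ℕ} (hq : 1 < q)
    (v : A) (x : ℕ → A) (m : ℕ) :
    (isogPoly q v x m).Monic ∧ (isogPoly q v x m).natDegree = q ^ m := by
  induction m with
  | zero => simp [isogPoly]
  | succ m ih =>
    obtain ⟨hm, hd⟩ := ih
    have hd' : (isogPoly q v x m ^ q).natDegree = q ^ (m + 1) := by
      rw [hm.natDegree_pow, hd, pow_succ']
    have hlt : (C (v ^ q ^ m * x m ^ (q - 1)) * isogPoly q v x m).natDegree <
        (isogPoly q v x m ^ q).natDegree := by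
      refine (natDegree_C_mul_le _ _).trans_lt ?_
      rw [hd, hd']
      exact Nat.pow_lt_pow_right hq (Nat.lt_succ_self m)
    refine ⟨(hm.pow q).sub_of_left (degree_lt_degree hlt), ?_⟩
    rw [isogPoly, natDegree_sub_eq_left_of_natDegree_lt hlt, hd']

end IsogPoly

theorem map_mulLeft_one {k Ω : Type*} [Field k] [Field Ω] [Algebra k Ω]
    (G : Submodule k Ω) : G.map (LinearMap.mulLeft k (1 : Ω)) = G := by
  rw [LinearMap.mulLeft_one, Submodule.map_id]

variable {k : Type*} [Field k] [Fintype k] {Ω : Type*} [Field Ω] [Algebra k Ω]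

section TowerOp

variable (k) in
/-- The operator `P_{xₘ} ∘ ⋯ ∘ P_{x₁}` attached to the first `m` terms of a sequence. -/
def towerOp (x : ℕ → Ω) : ℕ → Module.End k Ω
  | 0 => 1
  | m + 1 => opP k (x m) * towerOp x m

theorem levelGroup_eq_ker_towerOp {n : ℕ} (x : ℕ → Ω) :
    levelGroup k (fun i : Fin n => x i) = LinearMap.ker (towerOp k x n) := by
  have : ((List.ofFn fun i : Fin n => opP k (x i)).reverse.prod) = towerOp k x n := by
    induction n with
    | zero => simp [towerOp]
    | succ n ih =>
      rw [List.ofFn_succ', List.concat_eq_append, List.reverse_append, List.prod_append]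
      simp only [Fin.val_castSucc, ih, Fin.val_last, List.reverse_singleton, List.prod_singleton,
        towerOp]
  rw [levelGroup, this]

theorem towerOp_congr {x y : ℕ → Ω} {m : ℕ} (h : ∀ i < m, x i = y i) :
    towerOp k x m = towerOp k y m := by
  induction m with
  | zero => rfl
  | succ m ih => rw [towerOp, towerOp, ih fun i hi => h i (by omega), h m (by omega)]

theorem neg_one_pow_pow_card (m : ℕ) :
    (((-1) ^ m : Ω)) ^ Fintype.card k = (-1) ^ m := by
  have : ((-1 : Ω)) ^ Fintype.card k = -1 := by
    have := algebraMap_pow_card (Ω := Ω) (-1 : k)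
    simpa using this
  rw [← pow_mul, mul_comm, pow_mul, this]

/-- The sign makes the polynomial monic: each `P_x` has leading coefficient `-1`. Scaling the kernel
by `u` changes the recursion only through `u^(q-1)`, so the polynomial of `uG` is defined even where
`u` is not. -/
theorem eval_isogPoly {u : Ω} (x : ℕ → Ω) (m : ℕ) (y : Ω) :
    (isogPoly (Fintype.card k) (u ^ (Fintype.card k - 1)) x m).eval (u * y) =
      (-1) ^ m * u ^ (Fintype.card k ^ m) * towerOp k x m y := by
  induction m with
  | zero => simp [isogPoly, towerOp]
  | succ m ih =>
    rw [isogPoly, towerOp, Module.End.mul_apply, opP_apply, eval_sub, eval_pow, eval_mul, eval_C,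
      ih, mul_pow, mul_pow, neg_one_pow_pow_card, ← pow_mul u, ← pow_succ]
    have h : (u ^ (Fintype.card k - 1)) ^ Fintype.card k ^ m * u ^ Fintype.card k ^ m =
        u ^ Fintype.card k ^ (m + 1) := by
      rw [← mul_pow, ← pow_succ, card_sub_add, ← pow_mul, pow_succ']
    rw [← h]
    ring

theorem eval_isogPoly_eq_zero_iff {u : Ω} (hu : u ≠ 0) (x : ℕ → Ω) (m : ℕ) (z : Ω) :
    (isogPoly (Fintype.card k) (u ^ (Fintype.card k - 1)) x m).eval z = 0 ↔
      z ∈ (LinearMap.ker (towerOp k x m)).map (LinearMap.mulLeft k u) := by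
  have hz : z = u * (u⁻¹ * z) := by rw [mul_inv_cancel_left₀ hu]
  constructor
  · intro h
    rw [hz, eval_isogPoly] at h
    refine ⟨u⁻¹ * z, ?_, hz.symm⟩
    simpa [hu] using h
  · rintro ⟨y, hy, rfl⟩
    rw [LinearMap.mulLeft_apply, eval_isogPoly, LinearMap.mem_ker.1 hy, mul_zero]

theorem mem_ker_towerOp_iff (x : ℕ → Ω) (m : ℕ) (z : Ω) :
    z ∈ LinearMap.ker (towerOp k x m) ↔ (isogPoly (Fintype.card k) 1 x m).eval z = 0 := by
  have := eval_isogPoly_eq_zero_iff (k := k) one_ne_zero x m z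
  rw [one_pow, map_mulLeft_one] at this
  exact this.symm

theorem finite_ker_towerOp (x : ℕ → Ω) (m : ℕ) :
    (LinearMap.ker (towerOp k x m) : Set Ω).Finite ∧
      (LinearMap.ker (towerOp k x m) : Set Ω).ncard ≤ Fintype.card k ^ m := by
  classical
  obtain ⟨hm, hd⟩ := isogPoly_monic_natDegree (Fintype.one_lt_card (α := k)) (1 : Ω) x m
  have h : (LinearMap.ker (towerOp k x m) : Set Ω) =
      (isogPoly (Fintype.card k) 1 x m).roots.toFinset := by
    ext z
    rw [SetLike.mem_coe, mem_ker_towerOp_iff, Finset.mem_coe, Multiset.mem_toFinset,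
      mem_roots hm.ne_zero, IsRoot.def]
  rw [h]
  refine ⟨Finset.finite_toSet _, ?_⟩
  rw [Set.ncard_coe_finset, ← hd]
  exact (Multiset.toFinset_card_le _).trans (card_roots' _)

end TowerOp

/-! ### Infinite sequences and the cyclic structure of the kernels -/

section Sequence

variable (k) in
/-- Infinite sequences all of whose initial segments are points. -/
def IsSeq (x : ℕ → Ω) : Prop :=
  (∀ i, x i ≠ 0) ∧ ∀ i, opQ k (x i) (x (i + 1)) = x i

theorem IsSeq.isPoint {x : ℕ → Ω} (hx : IsSeq k x) (n : ℕ) :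
    IsPoint k (fun i : Fin n => x i) := by
  refine ⟨fun i => hx.1 i, fun i j hij => ?_⟩
  have := hx.2 i
  rw [opQ_apply, hij] at this
  exact this

theorem exists_pow_card_add_eq {k Ω : Type*} [Field k] [Fintype k] [Field Ω] [IsAlgClosed Ω]
    (a b : Ω) :
    ∃ y : Ω, y ^ Fintype.card k + a * y = b := by
  have hq := Fintype.one_lt_card (α := k)
  have hd : (X ^ Fintype.card k + (C a * X - C b) : Polynomial Ω).degree = Fintype.card k := by
    rw [degree_add_eq_left_of_degree_lt, degree_X_pow]
    rw [degree_X_pow]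
    refine lt_of_le_of_lt (degree_le_of_natDegree_le (n := 1) ?_) (by exact_mod_cast hq)
    compute_degree
  obtain ⟨y, hy⟩ := IsAlgClosed.exists_root (X ^ Fintype.card k + (C a * X - C b) : Polynomial Ω) (by
    rw [hd]; exact_mod_cast (by omega : Fintype.card k ≠ 0))
  refine ⟨y, ?_⟩
  have : y ^ Fintype.card k + (a * y - b) = 0 := by simpa using hy
  linear_combination this

theorem opP_surjective [IsAlgClosed Ω] (x : Ω) : Function.Surjective (opP k x) := fun w => by
  obtain ⟨y, hy⟩ := exists_pow_card_add_eq (k := k) (-x ^ (Fintype.card k - 1)) (-w)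
  exact ⟨y, by rw [opP_apply]; linear_combination -hy⟩

theorem opQ_surjective [IsAlgClosed Ω] (x : Ω) : Function.Surjective (opQ k x) := fun w => by
  obtain ⟨y, hy⟩ := exists_pow_card_add_eq (k := k) (x ^ (Fintype.card k - 1))⁻¹ w
  exact ⟨y, by rw [opQ_apply]; linear_combination hy⟩

theorem towerOp_surjective [IsAlgClosed Ω] (x : ℕ → Ω) (m : ℕ) :
    Function.Surjective (towerOp k x m) := by
  induction m with
  | zero => exact Function.surjective_id
  | succ m ih => exact (opP_surjective (x m)).comp ih

/-- Prolonging a point indefinitely lets later inductions run over `ℕ` instead of `Fin n`. -/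
theorem exists_isSeq [IsAlgClosed Ω] {n : ℕ} [NeZero n] {x : Fin n → Ω} (hx : IsPoint k x) :
    ∃ y : ℕ → Ω, IsSeq k y ∧ x = fun i : Fin n => y i := by
  -- Past the given coordinates, the next term is any solution of `Q_a(X) = a`; it is nonzero since
  -- `a` is.
  choose s hs using fun a : Ω => opQ_surjective (k := k) a a
  let y : ℕ → Ω := fun m => Nat.rec (x 0) (fun m a => if h : m + 1 < n then x ⟨m + 1, h⟩ else s a) m
  have hy0 : y 0 = x 0 := rfl
  have hys : ∀ m, y (m + 1) = if h : m + 1 < n then x ⟨m + 1, h⟩ else s (y m) := fun m => rfl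
  have hxy : ∀ m (h : m < n), y m = x ⟨m, h⟩ := by
    intro m h
    cases m with
    | zero => exact hy0
    | succ m => rw [hys, dif_pos h]
  have hstep : ∀ m, opQ k (y m) (y (m + 1)) = y m := by
    intro m
    by_cases h : m + 1 < n
    · rw [hxy m (by omega), hxy (m + 1) h, opQ_apply]
      exact hx.2 ⟨m, by omega⟩ ⟨m + 1, h⟩ rfl
    · rw [hys, dif_neg h, hs]
  refine ⟨y, ⟨fun m => ?_, hstep⟩, funext fun i => (hxy i i.2).symm⟩
  induction m with
  | zero => exact hx.1 0
  | succ m ih =>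
    intro h
    have := hstep m
    rw [h, map_zero] at this
    exact ih this.symm

/-- `P` intertwines `QP = t_{x_m}` with `PQ = t_{x_{m+1}}`. -/
theorem IsSeq.towerOp_mul_opT {x : ℕ → Ω} (hx : IsSeq k x) (m : ℕ) :
    towerOp k x m * (tMod k (x 0)).opT k = (tMod k (x m)).opT k * towerOp k x m := by
  induction m with
  | zero => simp [towerOp]
  | succ m ih =>
    rw [towerOp, mul_assoc, ih, ← mul_assoc, ← mul_assoc,
      ← opP_mul_opQ (hx.1 m) (hx.1 (m + 1)) (hx.2 m), ← opQ_mul_opP (hx.1 m)]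
    simp only [mul_assoc]

/-- Moving one `T` past `m` factors turns it into `Q P` for the next factor, and `Q_{x_m}(x_{m+1}) =
x_m` lowers the index by one. -/
theorem IsSeq.towerOp_opT_pow {x : ℕ → Ω} (hx : IsSeq k x) {n : ℕ} {y : Ω}
    (hy : towerOp k x n y = x n) {i m : ℕ} (him : i + m = n) :
    towerOp k x m (((tMod k (x 0)).opT k ^ i) y) = x m := by
  induction i generalizing m with
  | zero =>
    obtain rfl : m = n := by omega
    simpa using hy
  | succ i ih =>
    have h := ih (m := m + 1) (by omega)
    rw [pow_succ', Module.End.mul_apply, ← Module.End.mul_apply, hx.towerOp_mul_opT,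
      ← opQ_mul_opP (hx.1 m), Module.End.mul_apply, Module.End.mul_apply,
      ← Module.End.mul_apply (opP k (x m))]
    rw [towerOp] at h
    rw [h, hx.2]

theorem opT_tMod_self {x : Ω} (hx : x ≠ 0) : (tMod k x).opT k x = 0 := by
  rw [← opQ_mul_opP hx, Module.End.mul_apply, opP_self, map_zero]

theorem IsSeq.opT_pow_eq {x : ℕ → Ω} (hx : IsSeq k x) {n : ℕ} {y : Ω}
    (hy : towerOp k x n y = x n) : ((tMod k (x 0)).opT k ^ n) y = x 0 :=
  hx.towerOp_opT_pow hy (m := 0) (add_zero n)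

theorem IsSeq.opT_pow_succ_eq_zero {x : ℕ → Ω} (hx : IsSeq k x) {n : ℕ} {y : Ω}
    (hy : towerOp k x n y = x n) : ((tMod k (x 0)).opT k ^ (n + 1)) y = 0 := by
  rw [pow_succ', Module.End.mul_apply, hx.opT_pow_eq hy, opT_tMod_self (hx.1 0)]

theorem ncard_cyclicSpan {T : Module.End k Ω} {n : ℕ} {y : Ω}
    (h0 : (T ^ (n + 1)) y = 0) (h1 : (T ^ n) y ≠ 0) :
    (cyclicSpan T y : Set Ω).ncard = Fintype.card k ^ (n + 1) := by
  have : Module.Finite k (cyclicSpan T y) :=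
    Module.finite_of_finrank_pos (by rw [finrank_cyclicSpan h0 h1]; omega)
  rw [← finrank_cyclicSpan h0 h1, ← Nat.card_eq_fintype_card, ← Module.natCard_eq_pow_finrank]
  rfl

/-- The kernel is `T`-stable by intertwining, so it contains the span; the degree bound on the
kernel leaves no room for more. -/
theorem IsSeq.cyclicSpan_eq_ker {x : ℕ → Ω} (hx : IsSeq k x) {n : ℕ} {y : Ω}
    (h0 : ((tMod k (x 0)).opT k ^ (n + 1)) y = 0) (h1 : ((tMod k (x 0)).opT k ^ n) y ≠ 0)
    (hy : towerOp k x (n + 1) y = 0) :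
    cyclicSpan ((tMod k (x 0)).opT k) y = LinearMap.ker (towerOp k x (n + 1)) := by
  have hle : cyclicSpan ((tMod k (x 0)).opT k) y ≤ LinearMap.ker (towerOp k x (n + 1)) := by
    refine cyclicSpan_le hy fun z hz => ?_
    rw [LinearMap.mem_ker] at hz ⊢
    rw [← Module.End.mul_apply, hx.towerOp_mul_opT, Module.End.mul_apply, hz, map_zero]
  obtain ⟨hfin, hcard⟩ := finite_ker_towerOp (k := k) x (n + 1)
  refine SetLike.coe_injective (Set.eq_of_subset_of_ncard_le hle ?_ hfin)
  rwa [ncard_cyclicSpan h0 h1]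

theorem IsSeq.ker_towerOp_eq {x : ℕ → Ω} (hx : IsSeq k x) {n : ℕ} {y : Ω}
    (hy : towerOp k x n y = x n) :
    LinearMap.ker (towerOp k x (n + 1)) = cyclicSpan ((tMod k (x 0)).opT k) y := by
  refine (hx.cyclicSpan_eq_ker (hx.opT_pow_succ_eq_zero hy) ?_ ?_).symm
  · rw [hx.opT_pow_eq hy]
    exact hx.1 0
  · rw [towerOp, Module.End.mul_apply, hy, opP_self]

theorem IsSeq.ncard_ker [IsAlgClosed Ω] {x : ℕ → Ω} (hx : IsSeq k x) (n : ℕ) :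
    (LinearMap.ker (towerOp k x (n + 1)) : Set Ω).ncard = Fintype.card k ^ (n + 1) := by
  obtain ⟨y, hy⟩ := towerOp_surjective (k := k) x n (x n)
  rw [hx.ker_towerOp_eq hy, ncard_cyclicSpan (hx.opT_pow_succ_eq_zero hy)]
  rw [hx.opT_pow_eq hy]
  exact hx.1 0

theorem IsSeq.isLevel [IsAlgClosed Ω] {x : ℕ → Ω} (hx : IsSeq k x) (n : ℕ) :
    IsLevel k (tMod k (x 0)) (n + 1) (LinearMap.ker (towerOp k x (n + 1))) := by
  obtain ⟨y, hy⟩ := towerOp_surjective (k := k) x n (x n)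
  refine isLevel_iff.2 ⟨y, hx.opT_pow_succ_eq_zero hy, ?_, hx.ker_towerOp_eq hy⟩
  rw [hx.opT_pow_eq hy]
  exact hx.1 0

theorem IsSeq.map_opT_pow_ker [IsAlgClosed Ω] {x : ℕ → Ω} (hx : IsSeq k x) {i m n : ℕ}
    (h : i + m = n) :
    (LinearMap.ker (towerOp k x n)).map ((tMod k (x 0)).opT k ^ i) =
      LinearMap.ker (towerOp k x m) := by
  cases n with
  | zero =>
    obtain ⟨rfl, rfl⟩ : i = 0 ∧ m = 0 := by omega
    rw [pow_zero]
    exact Submodule.map_id _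
  | succ n =>
    obtain ⟨y, hy⟩ := towerOp_surjective (k := k) x n (x n)
    rw [hx.ker_towerOp_eq hy, map_pow_cyclicSpan]
    cases m with
    | zero =>
      obtain rfl : i = n + 1 := by omega
      rw [hx.opT_pow_succ_eq_zero hy]
      ext z
      rw [mem_cyclicSpan]
      simp [towerOp, eq_comm]
    | succ m =>
      exact (hx.ker_towerOp_eq (hx.towerOp_opT_pow hy (by omega))).symm

end Sequence

end Sequences

/-! ### Existence and uniqueness of the point attached to a triple -/

section Moduli

variable {k : Type*} [Field k] [Fintype k] {Ω : Type*} [Field Ω] [Algebra k Ω]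

theorem tMod_eq_of_opT_eq_zero {φ : DrinfeldModule Ω} (hφ : φ.IsNormalized) {x : Ω}
    (hx : x ≠ 0) (h : φ.opT k x = 0) : tMod k x = φ := by
  rw [opT_apply, hφ] at h
  ext
  · rw [tMod, div_eq_iff (pow_ne_zero _ hx)]
    linear_combination -h
  · exact hφ.symm

theorem pow_intertwine {k Ω : Type*} [Field k] [Field Ω] [Algebra k Ω]
    {T T' U : Module.End k Ω} (h : U * T = T' * U) (i : ℕ) (y : Ω) :
    (T' ^ i) (U y) = U ((T ^ i) y) := by
  have : U * T ^ i = T' ^ i * U := SemiconjBy.pow_right h i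
  rw [← Module.End.mul_apply, ← this, Module.End.mul_apply]

theorem cyclicSpan_intertwine {k Ω : Type*} [Field k] [Field Ω] [Algebra k Ω]
    {T T' U : Module.End k Ω} (h : U * T = T' * U) (y : Ω) :
    cyclicSpan T' (U y) = (cyclicSpan T y).map U := by
  have hp : ∀ p : k[X], aeval T' p (U y) = U (aeval T p y) := fun p => by
    rw [aeval_eq_sum_range, aeval_eq_sum_range, LinearMap.sum_apply, LinearMap.sum_apply, map_sum]
    exact Finset.sum_congr rfl fun i _ => by
      rw [LinearMap.smul_apply, LinearMap.smul_apply, map_smul, pow_intertwine h]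
  ext z
  simp only [Submodule.mem_map, mem_cyclicSpan]
  constructor
  · rintro ⟨p, rfl⟩
    exact ⟨_, ⟨p, rfl⟩, (hp p).symm⟩
  · rintro ⟨_, ⟨p, rfl⟩, rfl⟩
    exact ⟨p, hp p⟩

/-- Operators agree as functions on an infinite field exactly when the coefficients of `τ` and `τ²`
agree. -/
theorem mulLeft_mul_opT_iff [Infinite Ω] {φ ψ : DrinfeldModule Ω} {u : Ω} :
    LinearMap.mulLeft k u * φ.opT k = ψ.opT k * LinearMap.mulLeft k u ↔
      u * φ.g = ψ.g * u ^ Fintype.card k ∧ u * φ.Δ = ψ.Δ * u ^ (Fintype.card k ^ 2) := by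
  constructor
  · intro h
    have hq := Fintype.one_lt_card (α := k)
    have hne : Fintype.card k ^ 2 ≠ Fintype.card k := by nlinarith
    have hp : (C (u * φ.g - ψ.g * u ^ Fintype.card k) * X ^ Fintype.card k +
        C (u * φ.Δ - ψ.Δ * u ^ (Fintype.card k ^ 2)) * X ^ (Fintype.card k ^ 2) :
          Polynomial Ω) = 0 := by
      refine Polynomial.funext fun w => ?_
      have := LinearMap.congr_fun h w
      simp only [Module.End.mul_apply, opT_apply, LinearMap.mulLeft_apply, mul_pow] at this
      simp only [eval_add, eval_mul, eval_C, eval_pow, eval_X, eval_zero]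
      linear_combination this
    have h1 := congrArg (fun p => coeff p (Fintype.card k)) hp
    have h2 := congrArg (fun p => coeff p (Fintype.card k ^ 2)) hp
    simp only [coeff_add, coeff_C_mul, coeff_X_pow, coeff_zero, if_neg hne, if_neg hne.symm,
      mul_zero, add_zero, zero_add, if_true, mul_one] at h1 h2
    exact ⟨sub_eq_zero.1 h1, sub_eq_zero.1 h2⟩
  · rintro ⟨h1, h2⟩
    ext w
    simp only [Module.End.mul_apply, opT_apply, LinearMap.mulLeft_apply, mul_pow]
    linear_combination w ^ Fintype.card k * h1 + w ^ (Fintype.card k ^ 2) * h2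

theorem map_mulLeft_mul {k Ω : Type*} [Field k] [Field Ω] [Algebra k Ω]
    (u v : Ω) (G : Submodule k Ω) :
    G.map (LinearMap.mulLeft k (u * v)) =
      (G.map (LinearMap.mulLeft k v)).map (LinearMap.mulLeft k u) := by
  rw [LinearMap.mulLeft_mul, Submodule.map_comp]

theorem IsIso.symm {u : Ω} {φ ψ : DrinfeldModule Ω} {G H : Submodule k Ω}
    (h : IsIso k u φ G ψ H) : IsIso k u⁻¹ ψ H φ G := by
  obtain ⟨hu, hT, rfl⟩ := h
  have h1 : LinearMap.mulLeft k u⁻¹ * LinearMap.mulLeft k u = 1 := by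
    ext w
    simp [hu]
  have h2 : LinearMap.mulLeft k u * LinearMap.mulLeft k u⁻¹ = 1 := by
    ext w
    simp [hu]
  refine ⟨inv_ne_zero hu, ?_, by rw [← map_mulLeft_mul, inv_mul_cancel₀ hu, map_mulLeft_one]⟩
  calc LinearMap.mulLeft k u⁻¹ * ψ.opT k
      = LinearMap.mulLeft k u⁻¹ * (ψ.opT k * LinearMap.mulLeft k u) * LinearMap.mulLeft k u⁻¹ := by
        rw [mul_assoc, mul_assoc, h2, mul_one]
    _ = φ.opT k * LinearMap.mulLeft k u⁻¹ := by
        rw [← hT, ← mul_assoc (LinearMap.mulLeft k u⁻¹), h1, one_mul]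

theorem IsIso.trans {u v : Ω} {φ ψ χ : DrinfeldModule Ω} {G H I : Submodule k Ω}
    (h : IsIso k u φ G ψ H) (h' : IsIso k v ψ H χ I) : IsIso k (v * u) φ G χ I := by
  obtain ⟨hu, hT, rfl⟩ := h
  obtain ⟨hv, hT', rfl⟩ := h'
  refine ⟨mul_ne_zero hv hu, ?_, map_mulLeft_mul _ _ _⟩
  rw [LinearMap.mulLeft_mul, ← Module.End.mul_eq_comp, mul_assoc, hT, ← mul_assoc, hT', mul_assoc]

theorem IsIso.isLevel {u : Ω} {φ ψ : DrinfeldModule Ω} {G H : Submodule k Ω}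
    (h : IsIso k u φ G ψ H) {n : ℕ} (hG : IsLevel k φ (n + 1) G) : IsLevel k ψ (n + 1) H := by
  obtain ⟨hu, hT, rfl⟩ := h
  obtain ⟨y, h0, h1, rfl⟩ := isLevel_iff.1 hG
  refine isLevel_iff.2 ⟨LinearMap.mulLeft k u y, ?_, ?_, (cyclicSpan_intertwine hT y).symm⟩
  · rw [pow_intertwine hT, h0, map_zero]
  · rw [pow_intertwine hT, LinearMap.mulLeft_apply]
    exact mul_ne_zero hu h1

/-- Every normalized module with level structure and marked torsion point comes from a sequence. -/
theorem exists_isSeq_of_isLevel [IsAlgClosed Ω] {φ : DrinfeldModule Ω} (hφ : φ.IsNormalized)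
    {n : ℕ} {G : Submodule k Ω} (hG : IsLevel k φ (n + 1) G) {x₁ : Ω} (hx₁ : x₁ ≠ 0)
    (hmem : x₁ ∈ G) (hT : φ.opT k x₁ = 0) :
    ∃ x : ℕ → Ω, IsSeq k x ∧ x 0 = x₁ ∧ LinearMap.ker (towerOp k x (n + 1)) = G := by
  obtain ⟨y₀, h0, h1, rfl⟩ := isLevel_iff.1 hG
  obtain ⟨c, hc⟩ := exists_smul_of_mem_cyclicSpan_of_apply_eq_zero h0 h1 hmem hT
  have hc0 : c ≠ 0 := by
    rintro rfl
    exact hx₁ (by rw [hc, zero_smul])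
  -- The generator is rescaled so that `T^n y` is the marked point.
  set y := c • y₀ with hydef
  have hy1 : (φ.opT k ^ n) y = x₁ := by rw [hydef, map_smul, ← hc]
  have hspan : cyclicSpan (φ.opT k) y = cyclicSpan (φ.opT k) y₀ := by
    ext z
    simp only [mem_cyclicSpan, hydef, map_smul]
    constructor
    · rintro ⟨p, rfl⟩
      exact ⟨C c * p, by simp [Module.algebraMap_end_apply]⟩
    · rintro ⟨p, rfl⟩
      exact ⟨C c⁻¹ * p, by simp [Module.algebraMap_end_apply, smul_smul, hc0]⟩
  have htφ : tMod k x₁ = φ := tMod_eq_of_opT_eq_zero hφ hx₁ hT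
  -- The value prescribed for `x m` is the one `IsSeq.towerOp_opT_pow` would force; at `m = n` it
  -- makes `y` a generator of the kernel.
  suffices h : ∀ m ≤ n, ∃ x : ℕ → Ω, IsSeq k x ∧ x 0 = x₁ ∧
      towerOp k x m ((φ.opT k ^ (n - m)) y) = x m by
    obtain ⟨x, hx, hx0, hxn⟩ := h n le_rfl
    refine ⟨x, hx, hx0, ?_⟩
    rw [Nat.sub_self, pow_zero, Module.End.one_apply] at hxn
    rw [hx.ker_towerOp_eq hxn, hx0, htφ, hspan]
  intro m
  induction m with
  | zero =>
    intro _
    obtain ⟨x, hx, hx0⟩ := exists_isSeq (k := k) (n := 1) (x := fun _ => x₁)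
      ⟨fun _ => hx₁, fun i j hij => by omega⟩
    refine ⟨x, hx, (congrFun hx0 0).symm, ?_⟩
    rw [towerOp, Nat.sub_zero, hy1]
    exact congrFun hx0 0
  | succ m ih =>
    intro hm
    obtain ⟨x, hx, hx0, hxm⟩ := ih (by omega)
    set w := towerOp k x (m + 1) ((φ.opT k ^ (n - (m + 1))) y) with hw
    have hQ : opQ k (x m) w = x m := by
      rw [hw, towerOp, Module.End.mul_apply, ← Module.End.mul_apply (opQ k (x m)),
        opQ_mul_opP (hx.1 m), ← Module.End.mul_apply, ← hx.towerOp_mul_opT, Module.End.mul_apply,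
        hx0, htφ, ← Module.End.mul_apply (φ.opT k), ← pow_succ',
        show n - (m + 1) + 1 = n - m by omega, hxm]
    have hw0 : w ≠ 0 := by
      intro h
      rw [h, map_zero] at hQ
      exact hx.1 m hQ.symm
    -- Keep the terms up to `m`, replace the next one by `w`, and prolong arbitrarily.
    obtain ⟨x', hx', hxx'⟩ := exists_isSeq (k := k) (n := m + 2)
      (x := fun i => if (i : ℕ) ≤ m then x i else w) ⟨fun i => by
        dsimp only
        split_ifs
        exacts [hx.1 _, hw0], fun i j hij => by
        dsimp only
        have hi : (i : ℕ) ≤ m := by omega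
        rw [if_pos hi]
        split_ifs with hj
        · rw [← opQ_apply, ← hij, hx.2]
        · have : (i : ℕ) = m := by omega
          rw [← opQ_apply, this, hQ]⟩
    have hlt : ∀ i ≤ m, x i = x' i := fun i hi => by
      have := congrFun hxx' ⟨i, by omega⟩
      simpa [hi] using this
    refine ⟨x', hx', by rw [← hlt 0 (by omega), hx0], ?_⟩
    rw [← towerOp_congr fun i hi => hlt i (by omega), ← hw]
    have := congrFun hxx' ⟨m + 1, by omega⟩
    simpa using this

/-- If the terms up to `i` agree, equality of the kernels one level up puts `x (i+1)` on the line `k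
· x' (i+1)`. The linear map `Q_{x_i}` sends both to `x i ≠ 0`, so the scalar is `1`. The
intermediate kernels agree because they are the images of the top one under powers of `T`. -/
theorem IsSeq.eq_of_ker_eq [IsAlgClosed Ω] {x x' : ℕ → Ω} (hx : IsSeq k x) (hx' : IsSeq k x')
    (h0 : x 0 = x' 0) {n : ℕ}
    (hker : LinearMap.ker (towerOp k x (n + 1)) = LinearMap.ker (towerOp k x' (n + 1)))
    {i : ℕ} (hi : i ≤ n) : x i = x' i := by
  suffices h : ∀ i ≤ n, ∀ j ≤ i, x j = x' j from h i hi i le_rfl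
  intro i
  induction i with
  | zero =>
    intro _ j hj
    obtain rfl : j = 0 := by omega
    exact h0
  | succ i ih =>
    intro hi j hj
    have ih' := ih (by omega)
    rcases hj.lt_or_eq with hlt | rfl
    · exact ih' j (by omega)
    have hR : towerOp k x (i + 1) = towerOp k x' (i + 1) :=
      towerOp_congr fun j hj => ih' j (by omega)
    have hk : LinearMap.ker (towerOp k x (i + 1 + 1)) =
        LinearMap.ker (towerOp k x' (i + 1 + 1)) := by
      rw [← hx.map_opT_pow_ker (show n - (i + 1) + (i + 1 + 1) = n + 1 by omega),
        ← hx'.map_opT_pow_ker (show n - (i + 1) + (i + 1 + 1) = n + 1 by omega), hker, h0]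
    obtain ⟨y, hy⟩ := towerOp_surjective (k := k) x (i + 1) (x (i + 1))
    have hmem : y ∈ LinearMap.ker (towerOp k x (i + 1 + 1)) := by
      rw [LinearMap.mem_ker, towerOp, Module.End.mul_apply, hy, opP_self]
    rw [hk, LinearMap.mem_ker, towerOp, Module.End.mul_apply, ← hR, hy] at hmem
    obtain ⟨c, hc⟩ := (mem_ker_opP (hx'.1 (i + 1))).1 hmem
    have hQ := hx.2 i
    rw [hc, map_smul, ih' i le_rfl, hx'.2 i] at hQ
    have hc1 : c = 1 := by
      rw [← sub_eq_zero, ← smul_eq_zero_iff_left (hx'.1 i), sub_smul, hQ, one_smul, sub_self]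
    rw [hc, hc1, one_smul]

end Moduli

/-! ### Twisting by `u` with `u^(q²) = u`, and isomorphisms of pairs -/

section Action

variable {k : Type*} [Field k] [Fintype k] {Ω : Type*} [Field Ω] [Algebra k Ω]

variable (k) in
/-- The twist of a sequence by `u`. -/
def twist (u : Ω) (x : ℕ → Ω) : ℕ → Ω := fun i => u ^ (Fintype.card k ^ i) * x i

theorem twist_pow_sq {k Ω : Type*} [Fintype k] [Field Ω] {u : Ω}
    (hu : u ^ (Fintype.card k ^ 2) = u) (i : ℕ) :
    (u ^ (Fintype.card k ^ i)) ^ (Fintype.card k ^ 2) = u ^ (Fintype.card k ^ i) := by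
  rw [← pow_mul, mul_comm, pow_mul, hu]

/-- This is why the exponents in the action are successive powers of `q`: the coefficient scales by
`u^(1-q)` and `τ` by `u^(q²) = u`. -/
theorem opQ_mul {u x y : Ω} (hu0 : u ≠ 0) (hu : u ^ (Fintype.card k ^ 2) = u) :
    opQ k (u * x) (u ^ Fintype.card k * y) = u * opQ k x y := by
  rw [pow_two, pow_mul] at hu
  rw [opQ_apply, opQ_apply, mul_pow, mul_pow, hu, pow_card_eq (k := k) u, mul_inv]
  field_simp

theorem IsSeq.twisted {x : ℕ → Ω} (hx : IsSeq k x) {u : Ω} (hu0 : u ≠ 0)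
    (hu : u ^ (Fintype.card k ^ 2) = u) : IsSeq k (twist k u x) := by
  refine ⟨fun i => mul_ne_zero (pow_ne_zero _ hu0) (hx.1 i), fun i => ?_⟩
  rw [twist, twist, pow_succ, pow_mul, opQ_mul (pow_ne_zero _ hu0) (twist_pow_sq hu i),
    hx.2]

theorem towerOp_twist_mul (u : Ω) (x : ℕ → Ω) (m : ℕ) :
    towerOp k (twist k u x) m * LinearMap.mulLeft k u =
      LinearMap.mulLeft k (u ^ (Fintype.card k ^ m)) * towerOp k x m := by
  induction m with
  | zero => simp [towerOp]
  | succ m ih =>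
    rw [towerOp, towerOp, mul_assoc, ih, ← mul_assoc, ← mul_assoc]
    congr 1
    ext w
    simp only [Module.End.mul_apply, LinearMap.mulLeft_apply, opP_apply, twist]
    rw [pow_succ, pow_mul, mul_pow, mul_pow, pow_card_eq (k := k) (u ^ Fintype.card k ^ m)]
    ring

theorem map_ker_towerOp {u : Ω} (hu0 : u ≠ 0) (x : ℕ → Ω) (m : ℕ) :
    (LinearMap.ker (towerOp k x m)).map (LinearMap.mulLeft k u) =
      LinearMap.ker (towerOp k (twist k u x) m) := by
  have key : ∀ w, towerOp k (twist k u x) m (u * w) =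
      u ^ (Fintype.card k ^ m) * towerOp k x m w := fun w =>
    LinearMap.congr_fun (towerOp_twist_mul (k := k) u x m) w
  ext z
  constructor
  · rintro ⟨w, hw, rfl⟩
    rw [LinearMap.mem_ker, LinearMap.mulLeft_apply, key, LinearMap.mem_ker.1 hw, mul_zero]
  · intro hz
    refine ⟨u⁻¹ * z, ?_, mul_inv_cancel_left₀ hu0 z⟩
    have := key (u⁻¹ * z)
    rw [mul_inv_cancel_left₀ hu0, LinearMap.mem_ker.1 hz] at this
    simpa [hu0] using this.symm

theorem tMod_mul_g {k Ω : Type*} [Fintype k] [Field Ω] {u x : Ω} (hu0 : u ≠ 0)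
    (hu : u ^ (Fintype.card k ^ 2) = u) :
    u * (tMod k x).g = (tMod k (u * x)).g * u ^ Fintype.card k := by
  simp only [tMod]
  rw [mul_pow, mul_pow, hu, ← mul_sub]
  field_simp

theorem isIso_twist [Infinite Ω] {u : Ω} (hu0 : u ≠ 0) (hu : u ^ (Fintype.card k ^ 2) = u)
    (x : ℕ → Ω) (m : ℕ) :
    IsIso k u (tMod k (x 0)) (LinearMap.ker (towerOp k x m)) (tMod k (twist k u x 0))
      (LinearMap.ker (towerOp k (twist k u x) m)) := by
  refine ⟨hu0, mulLeft_mul_opT_iff.2 ⟨?_, ?_⟩, map_ker_towerOp hu0 x m⟩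
  · rw [twist, pow_zero, pow_one]
    exact tMod_mul_g hu0 hu
  · simp [tMod, hu]

theorem towerOp_twist_algebraMap {c : k} (hc : c ≠ 0) (x : ℕ → Ω) (m : ℕ) :
    LinearMap.ker (towerOp k (twist k (algebraMap k Ω c) x) m) =
      LinearMap.ker (towerOp k x m) := by
  have hc' : algebraMap k Ω c ≠ 0 := by simpa using hc
  rw [← map_ker_towerOp hc']
  ext z
  constructor
  · rintro ⟨w, hw, rfl⟩
    rw [LinearMap.mulLeft_apply, ← Algebra.smul_def]
    exact Submodule.smul_mem _ _ hw
  · intro hz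
    refine ⟨c⁻¹ • z, Submodule.smul_mem _ _ hz, ?_⟩
    rw [LinearMap.mulLeft_apply, ← Algebra.smul_def, smul_smul, mul_inv_cancel₀ hc, one_smul]

theorem algebraMap_pow_card_pow (c : k) (i : ℕ) :
    algebraMap k Ω c ^ (Fintype.card k ^ i) = algebraMap k Ω c := by
  rw [← map_pow, FiniteField.pow_card_pow]

theorem tMod_algebraMap_mul {c : k} (hc : c ≠ 0) (x : Ω) :
    tMod k (algebraMap k Ω c * x) = tMod k x := by
  have hc' : algebraMap k Ω c ≠ 0 := by simpa using hc
  ext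
  · have := tMod_mul_g (k := k) (x := x) hc' (algebraMap_pow_card_pow c 2)
    rw [algebraMap_pow_card, mul_comm] at this
    exact (mul_right_cancel₀ hc' this).symm
  · rfl

/-- Two sequences with the same normalized pair differ by an element of `kˣ`. -/
theorem IsSeq.exists_eq_twist_of_pair_eq [IsAlgClosed Ω] {x y : ℕ → Ω} (hx : IsSeq k x)
    (hy : IsSeq k y) {n : ℕ} (hT : tMod k (x 0) = tMod k (y 0))
    (hG : LinearMap.ker (towerOp k x (n + 1)) = LinearMap.ker (towerOp k y (n + 1))) :
    ∃ c : kˣ, ∀ i ≤ n, y i = twist k (algebraMap k Ω c) x i := by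
  obtain ⟨w, hw⟩ := towerOp_surjective (k := k) x n (x n)
  have hk := hx.ker_towerOp_eq hw
  obtain ⟨w', hw'⟩ := towerOp_surjective (k := k) y n (y n)
  have hmem : y 0 ∈ cyclicSpan ((tMod k (x 0)).opT k) w := by
    rw [← hk, hG, hy.ker_towerOp_eq hw']
    have := pow_mem_cyclicSpan ((tMod k (y 0)).opT k) w' n
    rwa [hy.opT_pow_eq hw'] at this
  obtain ⟨c, hc⟩ := exists_smul_of_mem_cyclicSpan_of_apply_eq_zero (hx.opT_pow_succ_eq_zero hw)
    (by rw [hx.opT_pow_eq hw]; exact hx.1 0) hmem (by rw [hT]; exact opT_tMod_self (hy.1 0))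
  rw [hx.opT_pow_eq hw] at hc
  have hc0 : c ≠ 0 := by
    rintro rfl
    exact hy.1 0 (by rw [hc, zero_smul])
  have hc' : algebraMap k Ω c ≠ 0 := by simpa using hc0
  refine ⟨Units.mk0 c hc0, fun i hi => ?_⟩
  refine hy.eq_of_ker_eq (hx.twisted hc' (algebraMap_pow_card_pow c 2)) ?_
    (n := n) ?_ hi
  · rw [hc, twist, pow_zero, pow_one, Algebra.smul_def]
  · rw [towerOp_twist_algebraMap hc0, hG]

/-- Compare the coefficients of `τ²`, both equal to `-1`. -/
theorem IsIso.pow_card_sq_eq [Infinite Ω] {u x y : Ω} {G H : Submodule k Ω}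
    (h : IsIso k u (tMod k x) G (tMod k y) H) : u ^ (Fintype.card k ^ 2) = u := by
  have := (mulLeft_mul_opT_iff.1 h.2.1).2
  simp only [tMod] at this
  linear_combination this

/-- Two sequences with isomorphic pairs differ by the twist by an element of the quadratic
extension of `k`. -/
theorem IsSeq.exists_eq_twist_of_isIso [IsAlgClosed Ω] {x y : ℕ → Ω} (hx : IsSeq k x)
    (hy : IsSeq k y) {n : ℕ} {u : Ω}
    (h : IsIso k u (tMod k (x 0)) (LinearMap.ker (towerOp k x (n + 1))) (tMod k (y 0))
      (LinearMap.ker (towerOp k y (n + 1)))) :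
    ∃ w : Ω, w ≠ 0 ∧ w ^ (Fintype.card k ^ 2) = w ∧ ∀ i ≤ n, y i = twist k w x i := by
  have : Infinite Ω := IsAlgClosed.instInfinite
  have hu := h.pow_card_sq_eq
  have hu0 := h.1
  -- The twist of `x` by `u` has the same normalized pair as `y`, so the two differ by a scalar in
  -- `kˣ`, which is absorbed into `u`.
  have h' := isIso_twist hu0 hu x (n + 1)
  have hg := (mulLeft_mul_opT_iff.1 h.2.1).1
  have hg' := (mulLeft_mul_opT_iff.1 h'.2.1).1
  rw [hg] at hg'
  obtain ⟨c, hc⟩ := (hx.twisted hu0 hu).exists_eq_twist_of_pair_eq hy (n := n)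
    (DrinfeldModule.ext (mul_right_cancel₀ (pow_ne_zero _ hu0) hg'.symm) rfl)
    (by rw [← h'.2.2, h.2.2])
  refine ⟨algebraMap k Ω c * u, mul_ne_zero (by simp) hu0, ?_, fun i hi => ?_⟩
  · rw [mul_pow, hu, algebraMap_pow_card_pow]
  · rw [hc i hi]
    simp only [twist, mul_pow, mul_assoc]

/-- Every module with level structure is isomorphic to the one of a sequence. -/
theorem exists_isSeq_isIso [IsAlgClosed Ω] {φ : DrinfeldModule Ω} {n : ℕ} {G : Submodule k Ω}
    (hG : IsLevel k φ (n + 1) G) :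
    ∃ x : ℕ → Ω, IsSeq k x ∧ ∃ u, IsIso k u (tMod k (x 0))
      (LinearMap.ker (towerOp k x (n + 1))) φ G := by
  have : Infinite Ω := IsAlgClosed.instInfinite
  have hq := Fintype.one_lt_card (α := k)
  have hq2 : 0 < Fintype.card k ^ 2 - 1 := by
    have : 1 < Fintype.card k ^ 2 := Nat.one_lt_pow (by norm_num) hq
    omega
  -- Conjugation by `u` multiplies `Δ` by `u^(q²-1)`; this choice normalizes it to `-1`.
  obtain ⟨u, hu⟩ := IsAlgClosed.exists_pow_nat_eq (-φ.Δ⁻¹) hq2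
  have hu0 : u ≠ 0 := by
    rintro rfl
    rw [zero_pow hq2.ne'] at hu
    exact φ.Δ_ne_zero (inv_eq_zero.1 (neg_eq_zero.1 hu.symm))
  let ψ : DrinfeldModule Ω := ⟨φ.g * u ^ Fintype.card k / u, -1, neg_ne_zero.2 one_ne_zero⟩
  have hiso : IsIso k u ψ (G.map (LinearMap.mulLeft k u⁻¹)) φ G := by
    refine ⟨hu0, mulLeft_mul_opT_iff.2 ⟨?_, ?_⟩, ?_⟩
    · simp only [ψ]
      field_simp
    · have : u ^ (Fintype.card k ^ 2) = u ^ (Fintype.card k ^ 2 - 1) * u := by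
        rw [← pow_succ, Nat.sub_add_cancel (by omega)]
      rw [this, hu]
      have := φ.Δ_ne_zero
      simp only [ψ]
      field_simp
    · rw [← map_mulLeft_mul, mul_inv_cancel₀ hu0, map_mulLeft_one]
  have hlev := hiso.symm.isLevel hG
  obtain ⟨y, h0, h1, hspan⟩ := isLevel_iff.1 hlev
  obtain ⟨x, hx, hx0, hker⟩ := exists_isSeq_of_isLevel (φ := ψ) rfl hlev h1
    (by rw [hspan]; exact pow_mem_cyclicSpan _ _ _)
    (by rw [← Module.End.mul_apply, ← pow_succ', h0])
  refine ⟨x, hx, u, ?_⟩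
  have : tMod k (x 0) = ψ := by
    rw [hx0]
    exact tMod_eq_of_opT_eq_zero (φ := ψ) rfl h1 (by rw [← Module.End.mul_apply, ← pow_succ', h0])
  rw [this, hker]
  exact hiso

end Action

/-! ### `k₁` as the solutions of `u^(q²) = u` -/

section QuadraticExtension

variable {k k₁ Ω : Type*} [Field k] [Fintype k] [Field k₁] [Field Ω] [Algebra k k₁] [Algebra k₁ Ω]

theorem natCard_of_finrank_eq_two (hk₁ : Module.finrank k k₁ = 2) :
    Finite k₁ ∧ Nat.card k₁ = Fintype.card k ^ 2 := by
  have : Module.Finite k k₁ := Module.finite_of_finrank_pos (by omega)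
  refine ⟨Module.finite_of_finite k, ?_⟩
  rw [Module.natCard_eq_pow_finrank (K := k), hk₁, Nat.card_eq_fintype_card]

theorem algebraMap_pow_card_sq (hk₁ : Module.finrank k k₁ = 2) (c : k₁) :
    algebraMap k₁ Ω c ^ (Fintype.card k ^ 2) = algebraMap k₁ Ω c := by
  obtain ⟨h, hc⟩ := natCard_of_finrank_eq_two hk₁
  have := Fintype.ofFinite k₁
  rw [← hc, Nat.card_eq_fintype_card, algebraMap_pow_card]

theorem exists_unit_algebraMap_eq (hk₁ : Module.finrank k k₁ = 2) {u : Ω} (hu0 : u ≠ 0)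
    (hu : u ^ (Fintype.card k ^ 2) = u) : ∃ c : k₁ˣ, algebraMap k₁ Ω c = u := by
  obtain ⟨h, hc⟩ := natCard_of_finrank_eq_two hk₁
  have := Fintype.ofFinite k₁
  rw [← hc, Nat.card_eq_fintype_card] at hu
  obtain ⟨c, rfl⟩ := exists_algebraMap_eq_of_pow_card hu
  exact ⟨Units.mk0 c fun h => hu0 (by rw [h, map_zero]), rfl⟩

theorem algebraMap_unit_ne_zero (c : k₁ˣ) : algebraMap k₁ Ω c ≠ 0 := by simp

theorem act_eq_twist {k k₁ Ω : Type*} [Fintype k] [Field k₁] [Field Ω] [Algebra k₁ Ω] (c : k₁ˣ)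
    (x : ℕ → Ω) (n : ℕ) :
    act k c (fun i : Fin n => x i) = fun i : Fin n => twist k (algebraMap k₁ Ω c) x i := rfl

end QuadraticExtension

/-! ### The moduli statements for points -/

section Points

variable {k k₁ Ω : Type*} [Field k] [Fintype k] [Field k₁] [Field Ω] [IsAlgClosed Ω]
  [Algebra k k₁] [Algebra k₁ Ω] [Algebra k Ω]

theorem IsPoint.isPoint_act (hk₁ : Module.finrank k k₁ = 2) {n : ℕ} [NeZero n] {x : Fin n → Ω}
    (hx : IsPoint k x) (c : k₁ˣ) : IsPoint k (act k c x) := by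
  obtain ⟨y, hy, rfl⟩ := exists_isSeq hx
  rw [act_eq_twist]
  exact (hy.twisted (algebraMap_unit_ne_zero c) (algebraMap_pow_card_sq hk₁ _)).isPoint n

theorem IsPoint.exists_act_of_pair_eq [IsScalarTower k k₁ Ω] {n : ℕ} [NeZero n] {x y : Fin n → Ω}
    (hx : IsPoint k x)
    (hy : IsPoint k y) (hT : tMod k (x 0) = tMod k (y 0)) (hG : levelGroup k x = levelGroup k y) :
    ∃ c : kˣ, y = act k (Units.map (algebraMap k k₁).toMonoidHom c) x := by
  obtain ⟨m, rfl⟩ := Nat.exists_eq_succ_of_ne_zero (NeZero.ne n)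
  obtain ⟨x, hs, rfl⟩ := exists_isSeq hx
  obtain ⟨y, ht, rfl⟩ := exists_isSeq hy
  rw [levelGroup_eq_ker_towerOp, levelGroup_eq_ker_towerOp] at hG
  obtain ⟨c, hc⟩ := hs.exists_eq_twist_of_pair_eq ht (n := m) hT hG
  refine ⟨c, funext fun i => ?_⟩
  rw [hc i (by omega), act_eq_twist]
  simp [← IsScalarTower.algebraMap_apply]

theorem pair_act_algebraMap [IsScalarTower k k₁ Ω] {n : ℕ} [NeZero n] {x : Fin n → Ω}
    (hx : IsPoint k x) (c : kˣ) :
    tMod k (act k (Units.map (algebraMap k k₁).toMonoidHom c) x 0) = tMod k (x 0) ∧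
      levelGroup k (act k (Units.map (algebraMap k k₁).toMonoidHom c) x) = levelGroup k x := by
  obtain ⟨x, hs, rfl⟩ := exists_isSeq hx
  rw [act_eq_twist, levelGroup_eq_ker_towerOp, levelGroup_eq_ker_towerOp]
  have : algebraMap k₁ Ω ((Units.map (algebraMap k k₁).toMonoidHom c : k₁ˣ) : k₁) =
      algebraMap k Ω c := by simp [← IsScalarTower.algebraMap_apply]
  rw [this]
  refine ⟨?_, towerOp_twist_algebraMap c.ne_zero x n⟩
  simp only [twist, Fin.val_zero, pow_zero, pow_one]
  exact tMod_algebraMap_mul c.ne_zero _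

theorem IsPoint.isIso_act (hk₁ : Module.finrank k k₁ = 2) {n : ℕ} [NeZero n] {x : Fin n → Ω}
    (hx : IsPoint k x) (c : k₁ˣ) :
    IsIso k (algebraMap k₁ Ω c) (tMod k (x 0)) (levelGroup k x)
      (tMod k (act k c x 0)) (levelGroup k (act k c x)) := by
  have : Infinite Ω := IsAlgClosed.instInfinite
  obtain ⟨x, hs, rfl⟩ := exists_isSeq hx
  rw [act_eq_twist, levelGroup_eq_ker_towerOp, levelGroup_eq_ker_towerOp]
  simp only [Fin.val_zero]
  exact isIso_twist (algebraMap_unit_ne_zero c) (algebraMap_pow_card_sq hk₁ _) x n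

theorem IsPoint.exists_act_of_isIso (hk₁ : Module.finrank k k₁ = 2) {n : ℕ} [NeZero n]
    {x y : Fin n → Ω} (hx : IsPoint k x) (hy : IsPoint k y) {u : Ω}
    (h : IsIso k u (tMod k (x 0)) (levelGroup k x) (tMod k (y 0)) (levelGroup k y)) :
    ∃ c : k₁ˣ, y = act k c x := by
  obtain ⟨m, rfl⟩ := Nat.exists_eq_succ_of_ne_zero (NeZero.ne n)
  obtain ⟨x, hs, rfl⟩ := exists_isSeq hx
  obtain ⟨y, ht, rfl⟩ := exists_isSeq hy
  rw [levelGroup_eq_ker_towerOp, levelGroup_eq_ker_towerOp] at h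
  obtain ⟨w, hw0, hw, hxy⟩ := hs.exists_eq_twist_of_isIso ht (n := m) h
  obtain ⟨c, rfl⟩ := exists_unit_algebraMap_eq hk₁ hw0 hw
  exact ⟨c, funext fun i => hxy i (by omega)⟩

theorem existsUnique_isPoint {n : ℕ} [NeZero n] {φ : DrinfeldModule Ω} {x₁ : Ω}
    {G : Submodule k Ω} (hφ : φ.IsNormalized) (hG : IsLevel k φ n G) (hx₁ : x₁ ≠ 0)
    (hmem : x₁ ∈ G) (hT : φ.opT k x₁ = 0) :
    ∃! x : Fin n → Ω, IsPoint k x ∧ x 0 = x₁ ∧ tMod k (x 0) = φ ∧ levelGroup k x = G := by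
  obtain ⟨m, rfl⟩ := Nat.exists_eq_succ_of_ne_zero (NeZero.ne n)
  obtain ⟨x, hx, hx0, hker⟩ := exists_isSeq_of_isLevel hφ hG hx₁ hmem hT
  refine ⟨fun i => x i, ⟨hx.isPoint _, hx0, ?_, ?_⟩, ?_⟩
  · simp only [Fin.val_zero, hx0]
    exact tMod_eq_of_opT_eq_zero hφ hx₁ hT
  · rw [levelGroup_eq_ker_towerOp, hker]
  · rintro y ⟨hy, hy0, -, hyG⟩
    obtain ⟨y, ht, rfl⟩ := exists_isSeq hy
    rw [levelGroup_eq_ker_towerOp, ← hker] at hyG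
    exact funext fun i => ht.eq_of_ker_eq hx (hy0.trans hx0.symm) (n := m) hyG (by omega)

theorem exists_isPoint_of_isLevel {n : ℕ} [NeZero n] {φ : DrinfeldModule Ω}
    {G : Submodule k Ω} (hφ : φ.IsNormalized) (hG : IsLevel k φ n G) :
    ∃ x : Fin n → Ω, IsPoint k x ∧ tMod k (x 0) = φ ∧ levelGroup k x = G := by
  obtain ⟨m, rfl⟩ := Nat.exists_eq_succ_of_ne_zero (NeZero.ne n)
  obtain ⟨y, h0, h1, hspan⟩ := isLevel_iff.1 hG
  obtain ⟨x, ⟨hx, -, hx'⟩, -⟩ := existsUnique_isPoint hφ hG h1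
    (by rw [hspan]; exact pow_mem_cyclicSpan _ _ _)
    (by rw [← Module.End.mul_apply, ← pow_succ', h0])
  exact ⟨x, hx, hx'⟩

theorem exists_isPoint_isIso {n : ℕ} [NeZero n] {φ : DrinfeldModule Ω} {G : Submodule k Ω}
    (hG : IsLevel k φ n G) :
    ∃ x : Fin n → Ω, IsPoint k x ∧ ∃ u : Ω, IsIso k u (tMod k (x 0)) (levelGroup k x) φ G := by
  obtain ⟨m, rfl⟩ := Nat.exists_eq_succ_of_ne_zero (NeZero.ne n)
  obtain ⟨x, hx, u, hu⟩ := exists_isSeq_isIso hG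
  refine ⟨fun i => x i, hx.isPoint _, u, ?_⟩
  rw [levelGroup_eq_ker_towerOp]
  exact hu

theorem IsPoint.triple {n : ℕ} [NeZero n] {x : Fin n → Ω} (hx : IsPoint k x) :
    IsLevel k (tMod k (x 0)) n (levelGroup k x) ∧
      x 0 ∈ levelGroup k x ∧ (tMod k (x 0)).opT k (x 0) = 0 ∧
      ∀ (m : ℕ) (hm : m ≤ n), levelGroup k (fun i : Fin m => x (Fin.castLE hm i)) =
        (levelGroup k x).map ((tMod k (x 0)).opT k ^ (n - m)) := by
  obtain ⟨l, rfl⟩ := Nat.exists_eq_succ_of_ne_zero (NeZero.ne n)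
  obtain ⟨x, hs, rfl⟩ := exists_isSeq hx
  rw [levelGroup_eq_ker_towerOp]
  simp only [Fin.val_zero, Fin.val_castLE]
  refine ⟨hs.isLevel l, ?_, opT_tMod_self (hs.1 0), fun m hm => ?_⟩
  · obtain ⟨y, hy⟩ := towerOp_surjective (k := k) x l (x l)
    rw [hs.ker_towerOp_eq hy]
    have := pow_mem_cyclicSpan ((tMod k (x 0)).opT k) y l
    rwa [hs.opT_pow_eq hy] at this
  · rw [levelGroup_eq_ker_towerOp, hs.map_opT_pow_ker (Nat.sub_add_cancel hm)]

/-- The points parametrize the Drinfeld modules with level structure. -/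
theorem moduli_points [IsScalarTower k k₁ Ω] (hk₁ : Module.finrank k k₁ = 2) (n : ℕ) [NeZero n] :
    (∀ x : Fin n → Ω, IsPoint k x →
        (∀ c : k₁ˣ, IsPoint k (act k c x)) ∧ act k (1 : k₁ˣ) x = x ∧
        ∀ c d : k₁ˣ, act k (c * d) x = act k c (act k d x)) ∧
      (∀ x : Fin n → Ω, IsPoint k x →
        IsLevel k (tMod k (x 0)) n (levelGroup k x) ∧
        x 0 ∈ levelGroup k x ∧ (tMod k (x 0)).opT k (x 0) = 0 ∧
        ∀ (m : ℕ) (hm : m ≤ n), levelGroup k (fun i : Fin m => x (Fin.castLE hm i)) =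
          (levelGroup k x).map ((tMod k (x 0)).opT k ^ (n - m))) ∧
      (∀ (φ : DrinfeldModule Ω) (x₁ : Ω) (G : Submodule k Ω), φ.IsNormalized →
        IsLevel k φ n G → x₁ ≠ 0 → x₁ ∈ G → φ.opT k x₁ = 0 →
        ∃! x : Fin n → Ω, IsPoint k x ∧ x 0 = x₁ ∧ tMod k (x 0) = φ ∧ levelGroup k x = G) ∧
      (∀ (φ : DrinfeldModule Ω) (G : Submodule k Ω), φ.IsNormalized → IsLevel k φ n G →
        ∃ x : Fin n → Ω, IsPoint k x ∧ tMod k (x 0) = φ ∧ levelGroup k x = G) ∧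
      (∀ x y : Fin n → Ω, IsPoint k x → IsPoint k y →
        ((tMod k (x 0) = tMod k (y 0) ∧ levelGroup k x = levelGroup k y) ↔
          ∃ c : kˣ, y = act k (Units.map (algebraMap k k₁).toMonoidHom c) x)) ∧
      (∀ (φ : DrinfeldModule Ω) (G : Submodule k Ω), IsLevel k φ n G →
        ∃ x : Fin n → Ω, IsPoint k x ∧
          ∃ u : Ω, IsIso k u (tMod k (x 0)) (levelGroup k x) φ G) ∧
      (∀ x : Fin n → Ω, IsPoint k x → ∀ c : k₁ˣ,
        IsIso k (algebraMap k₁ Ω c) (tMod k (x 0)) (levelGroup k x)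
          (tMod k (act k c x 0)) (levelGroup k (act k c x))) ∧
      (∀ x y : Fin n → Ω, IsPoint k x → IsPoint k y →
        ((∃ u : Ω, IsIso k u (tMod k (x 0)) (levelGroup k x)
            (tMod k (y 0)) (levelGroup k y)) ↔
          ∃ c : k₁ˣ, y = act k c x)) := by
  refine ⟨fun x hx => ⟨hx.isPoint_act hk₁, ?_, fun c d => ?_⟩, fun x hx => hx.triple,
    fun φ x₁ G hφ hG hx₁ hmem hT => existsUnique_isPoint hφ hG hx₁ hmem hT,
    fun φ G hφ hG => exists_isPoint_of_isLevel hφ hG, fun x y hx hy => ⟨?_, ?_⟩,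
    fun φ G hG => exists_isPoint_isIso hG, fun x hx c => hx.isIso_act hk₁ c,
    fun x y hx hy => ⟨?_, ?_⟩⟩
  · funext i
    simp [act]
  · funext i
    simp [act, mul_pow, mul_assoc]
  · rintro ⟨hT, hG⟩
    exact hx.exists_act_of_pair_eq hy hT hG
  · rintro ⟨c, rfl⟩
    obtain ⟨h1, h2⟩ := pair_act_algebraMap (k₁ := k₁) hx c
    exact ⟨h1.symm, h2.symm⟩
  · rintro ⟨u, hu⟩
    exact hx.exists_act_of_isIso hk₁ hy hu
  · rintro ⟨c, rfl⟩
    exact ⟨_, hx.isIso_act hk₁ c⟩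

end Points

open IntermediateField

/-! ### Poles and linear independence -/

section Valuation

variable {K Ω : Type*} [Field K] [Field Ω] [Algebra K Ω]

/-- A transcendental element is a pole of some valuation that is trivial on the constants. -/
theorem exists_valuation_one_lt {a : Ω} (ha : Transcendental K a) :
    ∃ V : ValuationSubring Ω, V.valuation.IsTrivialOn K ∧ 1 < V.valuation a := by
  have ha' : a ∉ (integralClosure K Ω).toSubring := fun h =>
    ha ((mem_integralClosure_iff K Ω).1 h).isAlgebraic
  -- The integral closure of `K` is the intersection of the valuation rings containing it, so one of
  -- them omits `a`.
  obtain ⟨V, hV, haV⟩ := Subring.exists_le_valuationSubring_of_isIntegrallyClosedIn ha'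
  have hle : ∀ c : K, V.valuation (algebraMap K Ω c) ≤ 1 := fun c =>
    (V.valuation_le_one_iff _).2 (hV ((integralClosure K Ω).algebraMap_mem c))
  refine ⟨V, ⟨fun c hc => le_antisymm (hle c) ?_⟩, ?_⟩
  · have h1 := hle c⁻¹
    rw [map_inv₀, map_inv₀] at h1
    have h0 : V.valuation (algebraMap K Ω c) ≠ 0 := by simpa using hc
    exact (inv_le_one₀ (zero_lt_iff.2 h0)).1 h1
  · rwa [← not_le, V.valuation_le_one_iff]

variable {Γ : Type*} [LinearOrderedCommGroupWithZero Γ] {v : Valuation Ω Γ} [v.IsTrivialOn K]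

theorem exists_zpow_of_mem_adjoin {a : Ω} (ha : 1 < v a) {f : Ω} (hf : f ∈ K⟮a⟯) (hf0 : f ≠ 0) :
    ∃ d : ℤ, v f = v a ^ d := by
  obtain ⟨r, s, rfl⟩ := (mem_adjoin_simple_iff K f).1 hf
  have hr : r ≠ 0 := by
    rintro rfl
    simp at hf0
  have hs : s ≠ 0 := by
    rintro rfl
    simp at hf0
  refine ⟨r.natDegree - s.natDegree, ?_⟩
  have ha0 : v a ≠ 0 := (zero_lt_one.trans ha).ne'
  rw [map_div₀, valuation_aeval_eq_valuation_X_pow_natDegree_of_one_lt_valuation_X a ha hr,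
    valuation_aeval_eq_valuation_X_pow_natDegree_of_one_lt_valuation_X a ha hs,
    zpow_sub₀ ha0, zpow_natCast, zpow_natCast]

/-- If `v a = v b ^ N` and `b` is a pole of `v`, then `1, b, …, b^(N-1)` are linearly independent
over `K(a)`. -/
theorem linearIndependent_pow_of_valuation {a b : Ω} {N : ℕ} (hN : N ≠ 0) (hb : 1 < v b)
    (hab : v a = v b ^ N) : LinearIndependent K⟮a⟯ (fun i : Fin N => b ^ (i : ℕ)) := by
  classical
  have hb0 : v b ≠ 0 := (zero_lt_one.trans hb).ne'
  have ha : 1 < v a := by rw [hab]; exact one_lt_pow₀ hb hN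
  rw [Fintype.linearIndependent_iff]
  intro f hf
  by_contra! hne
  obtain ⟨i₀, hi₀⟩ := hne
  set s : Finset (Fin N) := Finset.univ.filter fun i => f i ≠ 0 with hs
  have hval : ∀ i ∈ s, ∃ d : ℤ, v (f i • b ^ (i : ℕ)) = v b ^ ((N : ℤ) * d + (i : ℕ)) := by
    intro i hi
    have hi' : (f i : Ω) ≠ 0 := by simpa [hs] using hi
    obtain ⟨d, hd⟩ := exists_zpow_of_mem_adjoin (K := K) ha (f i).2 hi'
    refine ⟨d, ?_⟩
    rw [show f i • b ^ (i : ℕ) = (f i : Ω) * b ^ (i : ℕ) from rfl, map_mul, hd, hab, map_pow,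
      zpow_add₀ hb0, zpow_mul, zpow_natCast, zpow_natCast]
  obtain ⟨j, hj, hmax⟩ := Finset.exists_max_image s (fun i => v (f i • b ^ (i : ℕ)))
    ⟨i₀, by simpa [hs] using hi₀⟩
  have hsum : ∑ i ∈ s, f i • b ^ (i : ℕ) = 0 := by
    rw [← hf]
    refine Finset.sum_subset (Finset.subset_univ _) fun i _ hi => ?_
    have : f i = 0 := by simpa [hs] using hi
    rw [this, zero_smul]
  -- The nonzero terms have values `v(b)^(N d + i)`, with exponents distinct modulo `N`; one term
  -- dominates strictly, so the sum cannot vanish.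
  have hlt : v (∑ i ∈ s, f i • b ^ (i : ℕ)) = v (f j • b ^ (j : ℕ)) := by
    refine v.map_sum_eq_of_lt hj fun i hi => ?_
    rw [Finset.mem_sdiff, Finset.mem_singleton] at hi
    refine lt_of_le_of_ne (hmax i hi.1) fun h => hi.2 ?_
    obtain ⟨d, hd⟩ := hval i hi.1
    obtain ⟨e, he⟩ := hval j hj
    rw [hd, he] at h
    have h' := zpow_right_injective₀ (zero_lt_one.trans hb) hb.ne' h
    have hmod := congrArg (· % (N : ℤ)) h'
    simp only [Int.mul_add_emod_self_left] at hmod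
    rw [Int.emod_eq_of_lt (by omega) (by omega), Int.emod_eq_of_lt (by omega) (by omega)] at hmod
    exact Fin.ext (by exact_mod_cast hmod)
  rw [hsum, map_zero] at hlt
  obtain ⟨e, he⟩ := hval j hj
  rw [he] at hlt
  exact zpow_ne_zero _ hb0 hlt.symm

end Valuation

/-! ### Recovering a subfield from the embeddings that fix it -/

section Descent

variable {K Ω : Type*} [Field K] [Field Ω] [IsAlgClosed Ω] [Algebra K Ω]

/-- An element of a separable extension `L` of `F` that is fixed by all `F`-embeddings of `L` lies
in `F`. -/
theorem mem_of_forall_embedding_eq {F L : IntermediateField K Ω} (hFL : F ≤ L)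
    (hsep : ∀ w ∈ L, IsSeparable F w) {w : Ω} (hw : w ∈ L)
    (h : ∀ τ : L →ₐ[K] Ω, (∀ a (ha : a ∈ F), τ ⟨a, hFL ha⟩ = a) → τ ⟨w, hw⟩ = w) : w ∈ F := by
  have hws := hsep w hw
  have hint : IsIntegral F w := hws.isIntegral
  -- Every conjugate of `w` is its image under an `F`-embedding of `L`, hence equals `w`; a
  -- separable minimal polynomial with one root is linear.
  have key : ∀ y : Ω, aeval y (minpoly F w) = 0 → y = w := by
    intro y hy
    let w' : extendScalars hFL := ⟨w, hw⟩
    have hmin : minpoly F w' = minpoly F w :=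
      (minpoly.algebraMap_eq (A := F) (B' := Ω) Subtype.val_injective w').symm
    obtain ⟨τ, hτ⟩ := exists_algHom_of_splits_of_aeval (F := F) (E := extendScalars hFL) (K := Ω)
      (x := w') (y := y) (fun s => ⟨by
        have := (hsep s s.2).isIntegral
        exact (isIntegral_algebraMap_iff (B := Ω) Subtype.val_injective).1 this,
        IsAlgClosed.splits _⟩) (by rw [hmin]; exact hy)
    have := h (τ.restrictScalars K) fun a ha => τ.commutes ⟨a, ha⟩
    rw [← hτ]
    exact this
  have hone : (minpoly F w).natDegree = 1 := by
    have hcard : ((minpoly F w).rootSet Ω).ncard = (minpoly F w).natDegree := by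
      rw [← Nat.card_coe_set_eq, Nat.card_eq_fintype_card,
        card_rootSet_eq_natDegree hws (IsAlgClosed.splits _)]
    have hset : (minpoly F w).rootSet Ω = {w} := by
      ext y
      rw [mem_rootSet, Set.mem_singleton_iff]
      refine ⟨fun hy => key y hy.2, ?_⟩
      rintro rfl
      exact ⟨minpoly.ne_zero hint, minpoly.aeval _ _⟩
    rw [← hcard, hset, Set.ncard_singleton]
  obtain ⟨a, ha⟩ := minpoly.mem_range_of_degree_eq_one F w
    (by rw [degree_eq_natDegree (minpoly.ne_zero hint), hone]; rfl)
  rw [← ha]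
  exact a.2

/-- If the `K`-embeddings of `L` that fix `F` are exactly the elements of `H`, then `F` is the fixed
field of `H`. -/
theorem fixedBy_eq {F L : IntermediateField K Ω} (hFL : F ≤ L)
    (hsep : ∀ w ∈ L, IsSeparable F w) {H : Subgroup (L ≃ₐ[K] L)}
    (h1 : ∀ σ ∈ H, ∀ a (ha : a ∈ F), (σ ⟨a, hFL ha⟩ : Ω) = a)
    (h2 : ∀ τ : L →ₐ[K] Ω, (∀ a (ha : a ∈ F), τ ⟨a, hFL ha⟩ = a) →
      ∃ σ ∈ H, ∀ w, τ w = (σ w : Ω)) : fixedBy H = F := by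
  refine le_antisymm ?_ fun a ha => ?_
  · intro w hw
    have hwL : w ∈ L := lift_le _ hw
    have hw' : (⟨w, hwL⟩ : L) ∈ fixedField H := (mem_lift (⟨w, hwL⟩ : L)).1 hw
    rw [mem_fixedField_iff] at hw'
    refine mem_of_forall_embedding_eq hFL hsep hwL fun τ hτ => ?_
    obtain ⟨σ, hσ, hστ⟩ := h2 τ hτ
    rw [hστ, hw' σ hσ]
  · refine (mem_lift (⟨a, hFL ha⟩ : L)).2 ?_
    rw [mem_fixedField_iff]
    exact fun σ hσ => Subtype.ext (h1 σ hσ a ha)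

/-- The separable closure of `F` is closed under roots of separable polynomials. -/
theorem mem_separableClosure_of_root {F Ω : Type*} [Field F] [Field Ω] [Algebra F Ω]
    {p : Polynomial Ω}
    (hp : p.Separable) (hcoeff : ∀ i, p.coeff i ∈ separableClosure F Ω) {a : Ω}
    (ha : p.eval a = 0) : a ∈ separableClosure F Ω := by
  obtain ⟨P, rfl⟩ : ∃ P : Polynomial (separableClosure F Ω), P.map (algebraMap _ Ω) = p := by
    rw [← mem_lifts, lifts_iff_coeff_lifts]
    exact fun i => ⟨⟨_, hcoeff i⟩, rfl⟩
  have hP : P.Separable := (separable_map _).1 hp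
  have hsep : IsSeparable (separableClosure F Ω) a :=
    hP.of_dvd (minpoly.dvd _ _ (by rwa [aeval_def, ← eval_map]))
  have := mem_separableClosure_iff.2 hsep
  rw [separableClosure.separableClosure_eq_bot] at this
  obtain ⟨b, rfl⟩ := this
  exact b.2

end Descent

/-! ### Extending homomorphisms to simple extensions -/

section Embedding

theorem exists_ringHom_adjoin_simple {L E M : Type*} [Field L] [Field E] [Field M] [Algebra L E]
    (f : L →+* M) {x : E} (hx : IsIntegral L x) {y : M} (hy : (minpoly L x).eval₂ f y = 0) :
    ∃ g : L⟮x⟯ →+* M, (∀ l : L, g (algebraMap L L⟮x⟯ l) = f l) ∧ g (AdjoinSimple.gen L x) = y := by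
  let := f.toAlgebra
  let g : L⟮x⟯ →ₐ[L] M := (algHomAdjoinIntegralEquiv L hx).symm
    ⟨y, mem_aroots.2 ⟨minpoly.ne_zero hx, hy⟩⟩
  exact ⟨g, g.commutes, algHomAdjoinIntegralEquiv_symm_apply_gen L hx _⟩

theorem exists_algHom_adjoin_transcendental {K Ω M : Type*} [Field K] [Field Ω] [Field M]
    [Algebra K Ω] [Algebra K M] {a : Ω} {b : M} (ha : Transcendental K a)
    (hb : Transcendental K b) : ∃ f : K⟮a⟯ →ₐ[K] M, f (AdjoinSimple.gen K a) = b := by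
  refine ⟨K⟮b⟯.val.comp ((RatFunc.algEquivOfTranscendental a ha).symm.trans
    (RatFunc.algEquivOfTranscendental b hb)).toAlgHom, ?_⟩
  simp

end Embedding

/-! ### Degrees in a tower with a totally ramified pole -/

section Tower

variable {K Ω : Type*} [Field K] [Field Ω] [Algebra K Ω]

variable (K) in
/-- The field `K(a₀)(a₀, …, aₘ)`, as an extension of `K(a₀)`. -/
abbrev towerField (a : ℕ → Ω) (m : ℕ) : IntermediateField K⟮a 0⟯ Ω :=
  adjoin K⟮a 0⟯ (Set.range fun i : Fin (m + 1) => a i)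

theorem mem_towerField (a : ℕ → Ω) {i m : ℕ} (h : i ≤ m) : a i ∈ towerField K a m :=
  subset_adjoin _ _ ⟨⟨i, by omega⟩, rfl⟩

theorem range_fin_succ {α : Type*} (a : ℕ → α) (m : ℕ) :
    (Set.range fun i : Fin (m + 1 + 1) => a i) =
      (Set.range fun i : Fin (m + 1) => a i) ∪ {a (m + 1)} := by
  ext z
  constructor
  · rintro ⟨i, rfl⟩
    rcases Fin.eq_castSucc_or_eq_last i with ⟨j, rfl⟩ | rfl
    · exact Or.inl ⟨j, rfl⟩
    · exact Or.inr rfl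
  · rintro (⟨i, rfl⟩ | rfl)
    · exact ⟨i.castSucc, rfl⟩
    · exact ⟨Fin.last _, rfl⟩

theorem towerField_zero (a : ℕ → Ω) : towerField K a 0 = ⊥ := by
  rw [towerField, adjoin_eq_bot_iff]
  rintro _ ⟨i, rfl⟩
  obtain rfl : i = 0 := Fin.ext (by omega)
  exact mem_bot.2 ⟨AdjoinSimple.gen K (a 0), rfl⟩

theorem towerField_succ (a : ℕ → Ω) (m : ℕ) :
    towerField K a (m + 1) =
      (adjoin (towerField K a m) {a (m + 1)}).restrictScalars K⟮a 0⟯ := by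
  rw [adjoin_adjoin_left, towerField, range_fin_succ]

theorem finrank_restrictScalars_adjoin_simple {F E Ω : Type*} [Field F] [Field E] [Field Ω]
    [Algebra F E] [Algebra E Ω] [Algebra F Ω] [IsScalarTower F E Ω] [FiniteDimensional F E]
    {x : Ω} (h : IsIntegral E x) :
    FiniteDimensional F (E⟮x⟯.restrictScalars F) ∧
      Module.finrank F (E⟮x⟯.restrictScalars F) =
        Module.finrank F E * (minpoly E x).natDegree := by
  have := adjoin.finiteDimensional h
  rw [← adjoin.finrank h]
  exact ⟨FiniteDimensional.trans F E E⟮x⟯, (Module.finrank_mul_finrank F E E⟮x⟯).symm⟩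

theorem finrank_towerField_succ (a : ℕ → Ω) (m : ℕ)
    (h : IsIntegral (towerField K a m) (a (m + 1))) [FiniteDimensional K⟮a 0⟯ (towerField K a m)] :
    FiniteDimensional K⟮a 0⟯ (towerField K a (m + 1)) ∧
    Module.finrank K⟮a 0⟯ (towerField K a (m + 1)) =
      Module.finrank K⟮a 0⟯ (towerField K a m) *
        (minpoly (towerField K a m) (a (m + 1))).natDegree := by
  have := finrank_restrictScalars_adjoin_simple (F := K⟮a 0⟯) h
  rwa [← towerField_succ] at this

variable {Γ : Type*} [LinearOrderedCommGroupWithZero Γ] {v : Valuation Ω Γ} [v.IsTrivialOn K]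

theorem valuation_zero_eq_pow {a : ℕ → Ω} {q : ℕ} (hv : ∀ m, v (a m) = v (a (m + 1)) ^ q)
    (m : ℕ) : v (a 0) = v (a m) ^ q ^ m := by
  induction m with
  | zero => simp
  | succ m ih => rw [ih, hv m, ← pow_mul, pow_succ']

/-- A tower with steps of degree at most `q` in which a pole is totally ramified has steps of
degree exactly `q`. -/
theorem finrank_towerField {a : ℕ → Ω} {q : ℕ} (hq : q ≠ 0) (h0 : 1 < v (a 0))
    (hv : ∀ m, v (a m) = v (a (m + 1)) ^ q)
    (hp : ∀ m, ∃ p : Polynomial (towerField K a m), p.Monic ∧ p.natDegree = q ∧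
      aeval (a (m + 1)) p = 0) (m : ℕ) :
    FiniteDimensional K⟮a 0⟯ (towerField K a m) ∧
      Module.finrank K⟮a 0⟯ (towerField K a m) = q ^ m := by
  -- Total ramification bounds the degree below, through the powers of `a m`; the equations bound it
  -- above.
  have hlow : ∀ m, FiniteDimensional K⟮a 0⟯ (towerField K a m) →
      q ^ m ≤ Module.finrank K⟮a 0⟯ (towerField K a m) := by
    intro m hfin
    have hN : q ^ m ≠ 0 := pow_ne_zero _ hq
    have hb : 1 < v (a m) := by
      rw [valuation_zero_eq_pow hv m] at h0
      exact (one_lt_pow_iff hN).1 h0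
    have hli := linearIndependent_pow_of_valuation (K := K) hN hb (valuation_zero_eq_pow hv m)
    have hli' : LinearIndependent K⟮a 0⟯
        (fun i : Fin (q ^ m) => (⟨a m, mem_towerField a le_rfl⟩ : towerField K a m) ^ (i : ℕ)) :=
      LinearIndependent.of_comp (towerField K a m).val.toLinearMap hli
    simpa using hli'.fintype_card_le_finrank
  induction m with
  | zero =>
    rw [towerField_zero]
    exact ⟨inferInstance, by simp⟩
  | succ m ih =>
    obtain ⟨hfin, hrank⟩ := ih
    obtain ⟨p, hmonic, hdeg, hroot⟩ := hp m
    have hint : IsIntegral (towerField K a m) (a (m + 1)) := ⟨p, hmonic, hroot⟩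
    obtain ⟨hfin', hrank'⟩ := finrank_towerField_succ a m hint
    refine ⟨hfin', le_antisymm ?_ (hlow _ hfin')⟩
    rw [hrank', hrank, pow_succ, ← hdeg]
    exact Nat.mul_le_mul_left _ (natDegree_le_natDegree (minpoly.min _ _ hmonic hroot))

theorem minpoly_towerField {a : ℕ → Ω} {q : ℕ} (hq : q ≠ 0) (h0 : 1 < v (a 0))
    (hv : ∀ m, v (a m) = v (a (m + 1)) ^ q)
    (hp : ∀ m, ∃ p : Polynomial (towerField K a m), p.Monic ∧ p.natDegree = q ∧
      aeval (a (m + 1)) p = 0) (m : ℕ) {p : Polynomial (towerField K a m)} (hmonic : p.Monic)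
    (hdeg : p.natDegree = q) (hroot : aeval (a (m + 1)) p = 0) :
    minpoly (towerField K a m) (a (m + 1)) = p := by
  have hint : IsIntegral (towerField K a m) (a (m + 1)) := ⟨p, hmonic, hroot⟩
  obtain ⟨hfin, hrank⟩ := finrank_towerField hq h0 hv hp m
  have h1 := (finrank_towerField_succ a m hint).2
  rw [(finrank_towerField hq h0 hv hp (m + 1)).2, hrank, pow_succ] at h1
  have h2 := Nat.eq_of_mul_eq_mul_left (pow_pos (Nat.pos_of_ne_zero hq) m) h1
  refine (eq_of_monic_of_dvd_of_natDegree_le (minpoly.monic hint) hmonic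
    (minpoly.dvd _ _ hroot) ?_).symm
  rw [hdeg, ← h2]

end Tower

/-! ### The tower of coordinates and conjugacy of generic points -/

section PointTower

variable {k K Ω : Type*} [Field k] [Fintype k] [Field K] [Field Ω] [Algebra k Ω] [Algebra K Ω]

/-- The polynomial `Q_x(X) - x`, monic of degree `q`. -/
def stepPoly (q : ℕ) {A : Type*} [Field A] (x : A) : Polynomial A :=
  X ^ q + (C (x ^ (q - 1))⁻¹ * X - C x)

theorem stepPoly_map (q : ℕ) {A B : Type*} [Field A] [Field B] (f : A →+* B) (x : A) :
    (stepPoly q x).map f = stepPoly q (f x) := by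
  simp [stepPoly]

theorem stepPoly_degree_lt {q : ℕ} (hq : 1 < q) {A : Type*} [Field A] (b c : A) :
    (C b * X - C c : Polynomial A).degree < q := by
  refine lt_of_le_of_lt (degree_le_of_natDegree_le (n := 1) ?_) (by exact_mod_cast hq)
  compute_degree

theorem stepPoly_monic {q : ℕ} (hq : 1 < q) {A : Type*} [Field A] (x : A) :
    (stepPoly q x).Monic :=
  monic_X_pow_add (stepPoly_degree_lt hq _ _)

theorem stepPoly_natDegree {q : ℕ} (hq : 1 < q) {A : Type*} [Field A] (x : A) :
    (stepPoly q x).natDegree = q := by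
  rw [stepPoly, natDegree_add_eq_left_of_degree_lt, natDegree_X_pow]
  rw [degree_X_pow]
  exact stepPoly_degree_lt hq _ _

theorem stepPoly_eval (q : ℕ) {A : Type*} [Field A] (x y : A) :
    (stepPoly q x).eval y = (x ^ (q - 1))⁻¹ * y + y ^ q - x := by
  simp [stepPoly]
  ring

theorem IsSeq.stepPoly_eval_eq_zero {x : ℕ → Ω} (hx : IsSeq k x) (m : ℕ) :
    (stepPoly (Fintype.card k) (x m)).eval (x (m + 1)) = 0 := by
  rw [stepPoly_eval, ← opQ_apply, hx.2, sub_self]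

theorem IsSeq.exists_poly {x : ℕ → Ω} (hx : IsSeq k x) (m : ℕ) :
    aeval (x (m + 1)) (stepPoly (Fintype.card k)
      (⟨x m, mem_towerField x le_rfl⟩ : towerField K x m)) = 0 := by
  rw [aeval_def, ← eval_map, stepPoly_map]
  exact hx.stepPoly_eval_eq_zero m

variable {Γ : Type*} [LinearOrderedCommGroupWithZero Γ]

/-- At a pole of `x m` the coefficient `x_m^(1-q)` is small, so `x_{m+1}` must have a pole too and
`x_{m+1}^q` dominates the left side. -/
theorem IsSeq.valuation_eq {x : ℕ → Ω} (hx : IsSeq k x) {v : Valuation Ω Γ} (h0 : 1 < v (x 0))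
    (m : ℕ) : 1 < v (x m) ∧ v (x m) = v (x (m + 1)) ^ Fintype.card k := by
  have hq := Fintype.one_lt_card (α := k)
  have step : ∀ m, 1 < v (x m) → 1 < v (x (m + 1)) ∧
      v (x m) = v (x (m + 1)) ^ Fintype.card k := by
    intro m hm
    have heq := hx.2 m
    rw [opQ_apply] at heq
    have hc : v ((x m ^ (Fintype.card k - 1))⁻¹) < 1 := by
      rw [map_inv₀, map_pow]
      exact inv_lt_one_of_one_lt₀ (one_lt_pow₀ hm (by omega))
    have h1 : 1 < v (x (m + 1)) := by
      by_contra! hle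
      refine hm.not_ge ?_
      rw [← heq]
      refine v.map_add_le ?_ ?_
      · rw [map_mul]
        exact mul_le_one' hc.le hle
      · rw [map_pow]
        exact pow_le_one' hle _
    refine ⟨h1, ?_⟩
    have hlt : v ((x m ^ (Fintype.card k - 1))⁻¹ * x (m + 1)) <
        v (x (m + 1) ^ Fintype.card k) := by
      rw [map_mul, map_pow]
      calc v ((x m ^ (Fintype.card k - 1))⁻¹) * v (x (m + 1))
          < 1 * v (x (m + 1)) := by
            exact mul_lt_mul_of_pos_right hc (zero_lt_one.trans h1)
        _ = v (x (m + 1)) ^ 1 := by rw [one_mul, pow_one]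
        _ ≤ v (x (m + 1)) ^ Fintype.card k := pow_le_pow_right₀ h1.le hq.le
    have := v.map_add_eq_of_lt_right hlt
    rw [heq, map_pow] at this
    exact this
  have hone : ∀ m, 1 < v (x m) := fun m => by
    induction m with
    | zero => exact h0
    | succ m ih => exact (step m ih).1
  exact ⟨hone m, (step m (hone m)).2⟩

theorem IsSeq.finrank_towerField {x : ℕ → Ω} (hx : IsSeq k x) (ht : Transcendental K (x 0))
    (m : ℕ) : Module.finrank K⟮x 0⟯ (towerField K x m) = Fintype.card k ^ m := by
  have hq := Fintype.one_lt_card (α := k)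
  obtain ⟨V, hV, h0⟩ := exists_valuation_one_lt ht
  exact (DrinfeldTower.finrank_towerField (by omega) h0 (fun m => (hx.valuation_eq h0 m).2)
    (fun m => ⟨_, stepPoly_monic hq _, stepPoly_natDegree hq _, hx.exists_poly m⟩) m).2

theorem IsSeq.minpoly_towerField {x : ℕ → Ω} (hx : IsSeq k x) (ht : Transcendental K (x 0))
    (m : ℕ) : minpoly (towerField K x m) (x (m + 1)) =
      stepPoly (Fintype.card k) (⟨x m, mem_towerField x le_rfl⟩ : towerField K x m) := by
  have hq := Fintype.one_lt_card (α := k)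
  obtain ⟨V, hV, h0⟩ := exists_valuation_one_lt ht
  exact DrinfeldTower.minpoly_towerField (by omega) h0 (fun m => (hx.valuation_eq h0 m).2)
    (fun m => ⟨_, stepPoly_monic hq _, stepPoly_natDegree hq _, hx.exists_poly m⟩) m
    (stepPoly_monic hq _) (stepPoly_natDegree hq _) (hx.exists_poly m)

/-- Any two generic points are conjugate over `K`. -/
theorem IsSeq.exists_ringHom {x y : ℕ → Ω} (hx : IsSeq k x) (hy : IsSeq k y)
    (htx : Transcendental K (x 0)) (hty : Transcendental K (y 0)) (m : ℕ) :
    ∃ f : towerField K x m →+* Ω, (∀ (c : K) (w : towerField K x m), (w : Ω) = algebraMap K Ω c →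
      f w = algebraMap K Ω c) ∧ ∀ i ≤ m, ∀ w : towerField K x m, (w : Ω) = x i → f w = y i := by
  induction m with
  | zero =>
    obtain ⟨f, hf⟩ := exists_algHom_adjoin_transcendental htx hty
    -- Elements are identified by their values in `Ω`, so the claim survives rewriting the field
    -- itself; the successor step uses the same device.
    rw [towerField_zero]
    refine ⟨f.toRingHom.comp (botEquiv K⟮x 0⟯ Ω).toRingEquiv.toRingHom, ?_, ?_⟩
    · intro c w hw
      obtain rfl : w = algebraMap K⟮x 0⟯ _ (algebraMap K K⟮x 0⟯ c) := Subtype.ext hw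
      have : botEquiv K⟮x 0⟯ Ω (algebraMap K⟮x 0⟯ _ (algebraMap K K⟮x 0⟯ c)) =
        algebraMap K K⟮x 0⟯ c := botEquiv_def _
      exact (congrArg f this).trans (f.commutes c)
    · intro i hi w hw
      obtain rfl : i = 0 := by omega
      obtain rfl : w = algebraMap K⟮x 0⟯ _ (AdjoinSimple.gen K (x 0)) := Subtype.ext hw
      have : botEquiv K⟮x 0⟯ Ω (algebraMap K⟮x 0⟯ _ (AdjoinSimple.gen K (x 0))) =
        AdjoinSimple.gen K (x 0) := botEquiv_def _
      exact (congrArg f this).trans hf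
  | succ m ih =>
    have hq := Fintype.one_lt_card (α := k)
    obtain ⟨f, hfK, hf⟩ := ih
    have hint : IsIntegral (towerField K x m) (x (m + 1)) :=
      ⟨_, stepPoly_monic hq _, hx.exists_poly m⟩
    obtain ⟨g, hg, hgx⟩ := exists_ringHom_adjoin_simple f hint (y := y (m + 1)) (by
      rw [hx.minpoly_towerField htx, ← eval_map, stepPoly_map, hf m le_rfl _ rfl]
      exact hy.stepPoly_eval_eq_zero m)
    rw [towerField_succ]
    refine ⟨g, fun c w hw => ?_, fun i hi w hw => ?_⟩
    · have hc : algebraMap K Ω c ∈ towerField K x m :=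
        (towerField K x m).algebraMap_mem (algebraMap K K⟮x 0⟯ c)
      obtain rfl : w = algebraMap (towerField K x m) (towerField K x m)⟮x (m + 1)⟯ ⟨_, hc⟩ :=
        Subtype.ext hw
      exact (hg _).trans (hfK _ _ rfl)
    · rcases hi.lt_or_eq with hlt | rfl
      · obtain rfl : w = algebraMap (towerField K x m) (towerField K x m)⟮x (m + 1)⟯
          ⟨x i, mem_towerField x (by omega)⟩ := Subtype.ext hw
        exact (hg _).trans (hf i (by omega) _ rfl)
      · obtain rfl : w = AdjoinSimple.gen (towerField K x m) (x (m + 1)) := Subtype.ext hw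
        exact hgx

theorem restrictScalars_towerField (a : ℕ → Ω) (m : ℕ) :
    (towerField K a m).restrictScalars K = coordField K (fun i : Fin (m + 1) => a i) := by
  rw [adjoin_adjoin_left, Set.union_eq_self_of_subset_left]
  rw [Set.singleton_subset_iff]
  exact ⟨0, rfl⟩

theorem IsSeq.exists_algHom {x y : ℕ → Ω} (hx : IsSeq k x) (hy : IsSeq k y)
    (htx : Transcendental K (x 0)) (hty : Transcendental K (y 0)) (m : ℕ) :
    ∃ f : coordField K (fun i : Fin (m + 1) => x i) →ₐ[K] Ω,
      ∀ i ≤ m, ∀ w : coordField K (fun i : Fin (m + 1) => x i), (w : Ω) = x i → f w = y i := by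
  obtain ⟨f, hfK, hf⟩ := hx.exists_ringHom hy htx hty m
  rw [← restrictScalars_towerField]
  exact ⟨{ f with commutes' := fun c => hfK c _ rfl }, hf⟩

end PointTower

/-! ### Subfields fixed by an embedding -/

section FixedField

variable {K Ω : Type*} [Field K] [Field Ω] [Algebra K Ω]

/-- The elements of `L` that are fixed by the embedding `τ`. -/
def embFixed {L : IntermediateField K Ω} (τ : L →ₐ[K] Ω) : IntermediateField K Ω where
  carrier := {w | ∃ h : w ∈ L, τ ⟨w, h⟩ = w}
  mul_mem' := by
    rintro a b ⟨ha, ha'⟩ ⟨hb, hb'⟩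
    exact ⟨mul_mem ha hb, (map_mul τ ⟨a, ha⟩ ⟨b, hb⟩).trans (by rw [ha', hb'])⟩
  add_mem' := by
    rintro a b ⟨ha, ha'⟩ ⟨hb, hb'⟩
    exact ⟨add_mem ha hb, (map_add τ ⟨a, ha⟩ ⟨b, hb⟩).trans (by rw [ha', hb'])⟩
  algebraMap_mem' c := ⟨L.algebraMap_mem c, τ.commutes c⟩
  inv_mem' := by
    rintro a ⟨ha, ha'⟩
    exact ⟨inv_mem ha, (map_inv₀ τ ⟨a, ha⟩).trans (by rw [ha'])⟩

theorem coe_mem_embFixed {L : IntermediateField K Ω} {τ : L →ₐ[K] Ω} (w : L) :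
    (w : Ω) ∈ embFixed τ ↔ τ w = w :=
  ⟨fun h => h.2, fun h => ⟨w.2, h⟩⟩

theorem embFixed_le {L : IntermediateField K Ω} (τ : L →ₐ[K] Ω) : embFixed τ ≤ L :=
  fun _ h => h.1

theorem fixedBy_le_embFixed {L : IntermediateField K Ω} {H : Subgroup (L ≃ₐ[K] L)}
    {σ : L ≃ₐ[K] L} (hσ : σ ∈ H) : fixedBy H ≤ embFixed (L.val.comp σ.toAlgHom) := by
  intro w hw
  have hwL : w ∈ L := lift_le _ hw
  have hw' : (⟨w, hwL⟩ : L) ∈ fixedField H := (mem_lift (⟨w, hwL⟩ : L)).1 hw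
  rw [mem_fixedField_iff] at hw'
  exact ⟨hwL, congrArg Subtype.val (hw' σ hσ)⟩

/-- Common form of all the quotient computations: `F ≤ embFixed τ` can be tested on generators of
`F`, where it becomes an equality of moduli data. -/
theorem fixedBy_eq_of_embFixed [IsAlgClosed Ω] {F L : IntermediateField K Ω}
    (hsep : ∀ w ∈ L, IsSeparable F w) {H : Subgroup (L ≃ₐ[K] L)}
    (h1 : ∀ σ ∈ H, F ≤ embFixed (L.val.comp σ.toAlgHom))
    (h2 : ∀ τ : L →ₐ[K] Ω, F ≤ embFixed τ → ∃ σ ∈ H, τ = L.val.comp σ.toAlgHom) :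
    fixedBy H = F := by
  have hFL : F ≤ L := (h1 1 H.one_mem).trans (embFixed_le _)
  refine fixedBy_eq hFL hsep (fun σ hσ a ha => (h1 σ hσ ha).2) fun τ hτ => ?_
  obtain ⟨σ, hσ, rfl⟩ := h2 τ fun a ha => ⟨hFL ha, hτ a ha⟩
  exact ⟨σ, hσ, fun w => rfl⟩

variable (K) in
/-- The coordinate `x i` as an element of the field of coordinates. -/
def coordGen {n : ℕ} (x : Fin n → Ω) (i : Fin n) : coordField K x :=
  ⟨x i, subset_adjoin _ _ ⟨i, rfl⟩⟩

theorem coordField_algHom_ext {n : ℕ} {x : Fin n → Ω} {M : Type*} [Field M] [Algebra K M]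
    {τ τ' : coordField K x →ₐ[K] M} (h : ∀ i, τ (coordGen K x i) = τ' (coordGen K x i)) :
    τ = τ' := by
  refine adjoin_algHom_ext K ?_
  rintro _ ⟨i, rfl⟩
  exact h i

end FixedField

/-! ### Fields of definition of subgroups -/

section Isogeny

variable {k : Type*} [Field k] [Fintype k] {Ω : Type*} [Field Ω] [IsAlgClosed Ω] [Algebra k Ω]

/-- Both sides are monic, and the kernel has as many elements as the degree, so all roots are
simple. -/
theorem IsSeq.finprod_eq_isogPoly {x : ℕ → Ω} (hx : IsSeq k x) (m : ℕ) {u : Ω} (hu : u ≠ 0) :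
    ∏ᶠ y : (LinearMap.ker (towerOp k x (m + 1))).map (LinearMap.mulLeft k u), (X - C (y : Ω)) =
      isogPoly (Fintype.card k) (u ^ (Fintype.card k - 1)) x (m + 1) := by
  set G := (LinearMap.ker (towerOp k x (m + 1))).map (LinearMap.mulLeft k u) with hG
  set p := isogPoly (Fintype.card k) (u ^ (Fintype.card k - 1)) x (m + 1) with hp
  obtain ⟨hm, hd⟩ := isogPoly_monic_natDegree (Fintype.one_lt_card (α := k))
    (u ^ (Fintype.card k - 1)) x (m + 1)
  rw [← hp] at hm hd
  have hfin : (G : Set Ω).Finite := (finite_ker_towerOp (k := k) x (m + 1)).1.image _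
  have hcard : (G : Set Ω).ncard = Fintype.card k ^ (m + 1) := by
    rw [← hx.ncard_ker m]
    exact Set.ncard_image_of_injective _ (mul_right_injective₀ hu)
  have h1 : ∏ᶠ y : G, (X - C (y : Ω)) = ∏ y ∈ hfin.toFinset, (X - C y) := by
    rw [← finprod_mem_coe_finset, hfin.coe_toFinset]
    exact finprod_set_coe_eq_finprod_mem (f := fun y : Ω => X - C y) (G : Set Ω)
  rw [h1]
  refine (eq_of_monic_of_dvd_of_natDegree_le (monic_prod_X_sub_C _ _) hm ?_ ?_).symm
  · refine (Multiset.prod_X_sub_C_dvd_iff_le_roots hm.ne_zero hfin.toFinset.val).2 ?_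
    rw [Multiset.le_iff_subset hfin.toFinset.nodup]
    intro z hz
    rw [Finset.mem_val, Set.Finite.mem_toFinset] at hz
    rw [mem_roots hm.ne_zero]
    exact (eval_isogPoly_eq_zero_iff hu x (m + 1) z).2 hz
  · rw [hd, natDegree_prod_of_monic _ _ fun i _ => monic_X_sub_C i]
    simp [← Set.ncard_eq_toFinset_card (G : Set Ω) hfin, hcard]

variable {K : Type*} [Field K] [Algebra K Ω]

/-- An embedding that sends the point `x` to `y` and `u ^ (q - 1)` to `u' ^ (q - 1)` fixes the field
of definition of `u • G_x` if and only if `u' • G_y = u • G_x`. -/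
theorem isogCoeffs_subset_embFixed_iff {n : ℕ} [NeZero n] {x y : Fin n → Ω} (hx : IsPoint k x)
    (hy : IsPoint k y) {τ : coordField K x →ₐ[K] Ω} (hτ : ∀ i, τ (coordGen K x i) = y i)
    {u u' : Ω} (hu : u ≠ 0) (hu' : u' ≠ 0) {v : coordField K x}
    (hv : (v : Ω) = u ^ (Fintype.card k - 1)) (hv' : τ v = u' ^ (Fintype.card k - 1)) :
    isogCoeffs ((levelGroup k x).map (LinearMap.mulLeft k u)) ⊆ (embFixed τ : Set Ω) ↔
      (levelGroup k y).map (LinearMap.mulLeft k u') =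
        (levelGroup k x).map (LinearMap.mulLeft k u) := by
  obtain ⟨m, rfl⟩ := Nat.exists_eq_succ_of_ne_zero (NeZero.ne n)
  obtain ⟨x, hs, rfl⟩ := exists_isSeq hx
  obtain ⟨y, ht, rfl⟩ := exists_isSeq hy
  rw [levelGroup_eq_ker_towerOp, levelGroup_eq_ker_towerOp, isogCoeffs,
    hs.finprod_eq_isogPoly m hu]
  -- The coordinates lifted to `L`; the value `0` beyond `m` is never read. The polynomial built
  -- from them maps to that of `x` under inclusion and to that of `y` under `τ`.
  let xL : ℕ → coordField K (fun i : Fin (m + 1) => x i) := fun i =>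
    if h : i < m + 1 then coordGen K (fun i : Fin (m + 1) => x i) ⟨i, h⟩ else 0
  set pL := isogPoly (Fintype.card k) v xL (m + 1) with hpL
  set p := isogPoly (Fintype.card k) (u ^ (Fintype.card k - 1)) x (m + 1) with hp
  set p' := isogPoly (Fintype.card k) (u' ^ (Fintype.card k - 1)) y (m + 1) with hp'
  have hmap : pL.map (coordField K (fun i : Fin (m + 1) => x i)).val.toRingHom = p := by
    rw [hpL, isogPoly_map, hp, ← hv]
    refine isogPoly_congr _ _ fun i hi => ?_
    simp only [xL, dif_pos hi]
    rfl
  have hmap' : pL.map τ.toRingHom = p' := by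
    rw [hpL, isogPoly_map, hp', ← hv']
    refine isogPoly_congr _ _ fun i hi => ?_
    simp only [xL, dif_pos hi]
    exact hτ ⟨i, hi⟩
  have hcoeff : ∀ i, p.coeff i = (pL.coeff i : Ω) := fun i => by
    rw [← hmap, coeff_map]
    rfl
  have hcoeff' : ∀ i, p'.coeff i = τ (pL.coeff i) := fun i => by
    rw [← hmap', coeff_map]
    rfl
  have h1 : Set.range p.coeff ⊆ (embFixed τ : Set Ω) ↔ p' = p := by
    rw [Set.range_subset_iff, Polynomial.ext_iff]
    refine forall_congr' fun i => ?_
    rw [hcoeff, hcoeff', SetLike.mem_coe, coe_mem_embFixed]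
  rw [h1]
  constructor
  · intro h
    ext z
    rw [← eval_isogPoly_eq_zero_iff hu, ← eval_isogPoly_eq_zero_iff hu', ← hp, ← hp', h]
  · intro h
    rw [hp, hp', ← hs.finprod_eq_isogPoly m hu, ← ht.finprod_eq_isogPoly m hu', h]

end Isogeny

/-! ### Separability of the coordinates -/

section Separability

variable {k : Type*} [Field k] [Fintype k] {Ω : Type*} [Field Ω] [Algebra k Ω]

theorem cast_card_eq_zero : (Fintype.card k : Ω) = 0 := by
  rw [← map_natCast (algebraMap k Ω), FiniteField.cast_card_eq_zero, map_zero]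

theorem separable_of_derivative_eq_C {F : Type*} [Field F] {p : Polynomial F} {c : F} (hc : c ≠ 0)
    (h : derivative p = C c) : p.Separable := by
  rw [Polynomial.separable_def, h]
  exact ⟨0, C c⁻¹, by rw [zero_mul, zero_add, ← C_mul, inv_mul_cancel₀ hc, C_1]⟩

theorem stepPoly_separable {x : Ω} (hx : x ≠ 0) : (stepPoly (Fintype.card k) x).Separable := by
  refine separable_of_derivative_eq_C (c := (x ^ (Fintype.card k - 1))⁻¹) (by simp [hx]) ?_
  simp [stepPoly, derivative_X_pow, cast_card_eq_zero (k := k)]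

/-- `q + 1` equals `1` in `Ω`, so `X^(q+1) - a^(q+1)` is separable. -/
theorem mem_separableClosure_of_pow {F : Type*} [Field F] [Algebra F Ω] {a : Ω} (ha : a ≠ 0)
    (h : a ^ (Fintype.card k + 1) ∈ separableClosure F Ω) : a ∈ separableClosure F Ω := by
  refine mem_separableClosure_of_root
    (p := X ^ (Fintype.card k + 1) - C (a ^ (Fintype.card k + 1))) ?_ ?_ (by simp)
  · exact separable_X_pow_sub_C _ (by simp [cast_card_eq_zero (k := k)]) (pow_ne_zero _ ha)
  · intro i
    rw [coeff_sub, coeff_X_pow, coeff_C]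
    refine sub_mem ?_ ?_ <;> split_ifs
    exacts [one_mem _, zero_mem _, h, zero_mem _]

/-- `x` is a root of the `T`-torsion polynomial `X^(q²) - g X^q - X`, whose derivative is `-1`. -/
theorem mem_separableClosure_of_g {F : Type*} [Field F] [Algebra F Ω] {x : Ω} (hx : x ≠ 0)
    (h : (tMod k x).g ∈ separableClosure F Ω) : x ∈ separableClosure F Ω := by
  have hq := Fintype.one_lt_card (α := k)
  refine mem_separableClosure_of_root
    (p := X ^ (Fintype.card k ^ 2) - C (tMod k x).g * X ^ Fintype.card k - X) ?_ ?_ ?_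
  · refine separable_of_derivative_eq_C (c := -1) (by simp) ?_
    simp [derivative_X_pow, cast_card_eq_zero (k := k)]
  · intro i
    rw [coeff_sub, coeff_sub, coeff_C_mul, coeff_X_pow, coeff_X_pow, coeff_X]
    refine sub_mem (sub_mem ?_ (mul_mem h ?_)) ?_ <;> split_ifs <;>
      first | exact one_mem _ | exact zero_mem _
  · have := opT_tMod_self (k := k) hx
    rw [opT_apply] at this
    simp only [eval_sub, eval_pow, eval_X, eval_mul, eval_C]
    simp only [tMod] at this ⊢
    linear_combination -this

theorem IsSeq.mem_separableClosure {x : ℕ → Ω} (hx : IsSeq k x) {F : Type*} [Field F]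
    [Algebra F Ω] (h : x 0 ∈ separableClosure F Ω) (m : ℕ) : x m ∈ separableClosure F Ω := by
  have hq := Fintype.one_lt_card (α := k)
  induction m with
  | zero => exact h
  | succ m ih =>
    refine mem_separableClosure_of_root (stepPoly_separable (hx.1 m)) ?_
      (hx.stepPoly_eval_eq_zero m)
    intro i
    rw [stepPoly, coeff_add, coeff_sub, coeff_C_mul, coeff_X_pow, coeff_X, coeff_C]
    refine add_mem ?_ (sub_mem (mul_mem (inv_mem (pow_mem ih _)) ?_) ?_) <;> split_ifs <;>
      first | exact one_mem _ | exact zero_mem _ | exact ih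

theorem IsPoint.isSeparable [IsAlgClosed Ω] {K : Type*} [Field K] [Algebra K Ω] {n : ℕ} [NeZero n]
    {x : Fin n → Ω} (hx : IsPoint k x) {F : IntermediateField K Ω}
    (h : x 0 ∈ separableClosure F Ω) : ∀ w ∈ coordField K x, IsSeparable F w := by
  obtain ⟨x, hs, rfl⟩ := exists_isSeq hx
  have hle : coordField K (fun i : Fin n => x i) ≤ (separableClosure F Ω).restrictScalars K := by
    rw [adjoin_le_iff]
    rintro _ ⟨i, rfl⟩
    exact hs.mem_separableClosure h i
  exact fun w hw => mem_separableClosure_iff.1 (hle hw)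

end Separability

/-! ### The action of `k₁ˣ` on the coordinate field -/

section Automorphisms

variable {k k₁ K Ω : Type*} [Field k] [Fintype k] [Field k₁] [Field K] [Field Ω]
  [Algebra k k₁] [Algebra k₁ K] [Algebra K Ω] [Algebra k₁ Ω] [Algebra k Ω]
  [IsScalarTower k₁ K Ω]

theorem algHom_mem_of_coordGen {n : ℕ} {x : Fin n → Ω} {τ : coordField K x →ₐ[K] Ω}
    {L : IntermediateField K Ω} (h : ∀ i, τ (coordGen K x i) ∈ L) (w : coordField K x) :
    τ w ∈ L := by
  have hle : coordField K x ≤ (L.comap τ).map (coordField K x).val := by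
    rw [adjoin_le_iff]
    rintro _ ⟨i, rfl⟩
    exact ⟨coordGen K x i, h i, rfl⟩
  obtain ⟨w', hw', hww'⟩ := hle w.2
  rwa [← Subtype.ext hww']

theorem act_mem_coordField {k k₁ K Ω : Type*} [Fintype k] [Field k₁] [Field K] [Field Ω]
    [Algebra k₁ K] [Algebra K Ω] [Algebra k₁ Ω] [IsScalarTower k₁ K Ω] {n : ℕ} (x : Fin n → Ω)
    (c : k₁ˣ) (i : Fin n) : act k c x i ∈ coordField K x := by
  refine mul_mem (pow_mem ?_ _) (coordGen K x i).2
  rw [IsScalarTower.algebraMap_apply k₁ K Ω]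
  exact IntermediateField.algebraMap_mem _ _

theorem transcendental_algebraMap_mul {a : Ω} (ha : Transcendental K a) (c : k₁ˣ) :
    Transcendental K (algebraMap k₁ Ω c * a) := by
  intro h
  refine ha ?_
  have hc : IsAlgebraic K (algebraMap k₁ Ω c)⁻¹ := by
    rw [IsScalarTower.algebraMap_apply k₁ K Ω]
    exact (isAlgebraic_algebraMap _).inv
  have := hc.mul h
  rwa [inv_mul_cancel_left₀ (algebraMap_unit_ne_zero c)] at this

/-- The twisted point is again generic, hence conjugate to `x`. Its coordinates stay in the same
field because `K` contains `k₁`. -/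
theorem IsPoint.exists_algHom_act [IsAlgClosed Ω] (hk₁ : Module.finrank k k₁ = 2) {n : ℕ} [NeZero n]
    {x : Fin n → Ω} (hx : IsPoint k x) (ht : Transcendental K (x 0)) (c : k₁ˣ) :
    ∃ f : coordField K x →ₐ[K] coordField K x, ∀ i, (f (coordGen K x i) : Ω) =
      act k c x i := by
  suffices h : ∃ f : coordField K x →ₐ[K] Ω, ∀ i, f (coordGen K x i) =
      act k c x i by
    obtain ⟨f, hf⟩ := h
    exact ⟨f.codRestrict (coordField K x).toSubalgebra (algHom_mem_of_coordGen fun i => by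
      rw [hf]
      exact act_mem_coordField x c i), hf⟩
  obtain ⟨m, rfl⟩ := Nat.exists_eq_succ_of_ne_zero (NeZero.ne n)
  obtain ⟨x, hs, rfl⟩ := exists_isSeq hx
  have hs' := hs.twisted (algebraMap_unit_ne_zero c) (algebraMap_pow_card_sq hk₁ _)
  obtain ⟨f, hf⟩ := hs.exists_algHom hs' ht (by
    rw [twist, pow_zero, pow_one]
    exact transcendental_algebraMap_mul ht c) m
  exact ⟨f, fun i => hf i (by omega) _ rfl⟩

/-- The action of `k₁ˣ` on the field of coordinates of a generic point. -/
theorem IsPoint.exists_action [IsAlgClosed Ω] (hk₁ : Module.finrank k k₁ = 2) {n : ℕ} [NeZero n]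
    {x : Fin n → Ω}
    (hx : IsPoint k x) (ht : Transcendental K (x 0)) :
    ∃ σ : k₁ˣ →* (coordField K x ≃ₐ[K] coordField K x),
      ∀ c i, (σ c (coordGen K x i) : Ω) = act k c x i := by
  choose f hf using hx.exists_algHom_act hk₁ ht
  have hf' : ∀ c i, f c (coordGen K x i) =
      algebraMap K _ (algebraMap k₁ K c ^ (Fintype.card k ^ (i : ℕ))) * coordGen K x i := by
    intro c i
    refine Subtype.ext ?_
    rw [hf, DrinfeldTower.act, IsScalarTower.algebraMap_apply k₁ K Ω, ← map_pow]
    rfl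
  let F : k₁ˣ →* (coordField K x →ₐ[K] coordField K x) :=
    { toFun := f
      map_one' := coordField_algHom_ext fun i => by simp [hf']
      map_mul' := fun c d => coordField_algHom_ext fun i => by
        rw [AlgHom.mul_apply, hf', hf', map_mul, AlgHom.commutes, hf', Units.val_mul, map_mul,
          mul_pow, map_mul]
        ring }
  -- A homomorphism from a group into the endomorphism monoid lands in its units, the automorphisms.
  exact ⟨(AlgEquiv.algHomUnitsEquiv _ _).toMonoidHom.comp F.toHomUnits, fun c i => hf c i⟩

end Automorphisms

/-! ### Fields of definition at a generic point -/

section GenericPoint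

variable {k k₁ K Ω : Type*} [Field k] [Fintype k] [Field k₁] [Field K] [Field Ω]
  [Algebra k k₁] [Algebra K Ω] [Algebra k₁ Ω] [Algebra k Ω]

theorem map_tMod_g {k A B : Type*} [Fintype k] [Field A] [Field B] (f : A →+* B) (a : A) :
    f (tMod k a).g = (tMod k (f a)).g := by
  simp [tMod]

theorem IsPoint.image {k K Ω : Type*} [Fintype k] [Field K] [Field Ω] [Algebra K Ω]
    {n : ℕ} {x : Fin n → Ω} (hx : IsPoint k x) (τ : coordField K x →ₐ[K] Ω) :
    IsPoint k (fun i => τ (coordGen K x i)) := by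
  refine ⟨fun i => ?_, fun i j hij => ?_⟩
  · rw [Ne, map_eq_zero]
    exact fun h => hx.1 i (congrArg Subtype.val h)
  · have h : (coordGen K x i ^ (Fintype.card k - 1))⁻¹ * coordGen K x j +
        coordGen K x j ^ Fintype.card k = coordGen K x i := Subtype.ext (hx.2 i j hij)
    have := congrArg τ h
    simpa using this

theorem g_mem_embFixed_iff {k K Ω : Type*} [Fintype k] [Field K] [Field Ω] [Algebra K Ω]
    {n : ℕ} [NeZero n] {x y : Fin n → Ω} {τ : coordField K x →ₐ[K] Ω}
    (hτ : ∀ i, τ (coordGen K x i) = y i) :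
    (tMod k (x 0)).g ∈ embFixed τ ↔ (tMod k (y 0)).g = (tMod k (x 0)).g := by
  have h1 : (tMod k (x 0)).g = ((tMod k (coordGen K x 0)).g : coordField K x) :=
    (map_tMod_g (k := k) (coordField K x).val.toRingHom (coordGen K x 0)).symm
  have h2 : τ (tMod k (coordGen K x 0)).g = (tMod k (y 0)).g := by
    rw [← hτ]
    exact map_tMod_g (k := k) τ.toRingHom (coordGen K x 0)
  rw [h1, coe_mem_embFixed, h2]

theorem tMod_eq_iff {k Ω : Type*} [Fintype k] [Field Ω] {x y : Ω} : tMod k x = tMod k y ↔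
    (tMod k x).g = (tMod k y).g :=
  ⟨fun h => by rw [h], fun h => DrinfeldModule.ext h rfl⟩

theorem coord_mem_embFixed_iff {n : ℕ} {x y : Fin n → Ω} {τ : coordField K x →ₐ[K] Ω}
    (hτ : ∀ i, τ (coordGen K x i) = y i) (i : Fin n) : x i ∈ embFixed τ ↔ y i = x i := by
  rw [← hτ]
  exact coe_mem_embFixed (coordGen K x i)

theorem algHom_eq_val_comp {k k₁ K Ω : Type*} [Fintype k] [Field k₁] [Field K] [Field Ω]
    [Algebra K Ω] [Algebra k₁ Ω] {n : ℕ} {x : Fin n → Ω}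
    {σ : k₁ˣ →* (coordField K x ≃ₐ[K] coordField K x)}
    (hσ : ∀ c i, (σ c (coordGen K x i) : Ω) = act k c x i) {τ : coordField K x →ₐ[K] Ω} {c : k₁ˣ}
    (h : ∀ i, τ (coordGen K x i) = act k c x i) :
    τ = (coordField K x).val.comp (σ c).toAlgHom :=
  coordField_algHom_ext fun i => (h i).trans (hσ c i).symm

theorem pow_card_sub_one_pow {k Ω : Type*} [Field k] [Fintype k] [Field Ω] (u : Ω) :
    (u ^ (Fintype.card k - 1)) ^ (Fintype.card k + 1) * u = u ^ (Fintype.card k ^ 2) := by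
  obtain ⟨r, hr⟩ : ∃ r, Fintype.card k = r + 1 :=
    ⟨_, (Nat.sub_add_cancel Fintype.card_pos).symm⟩
  rw [hr, Nat.add_sub_cancel, ← pow_mul, ← pow_succ]
  congr 1
  ring

theorem IsIso.J_eq [Infinite Ω] {u : Ω} {φ ψ : DrinfeldModule Ω} {G H : Submodule k Ω}
    (h : IsIso k u φ G ψ H) : φ.J k = ψ.J k := by
  obtain ⟨hu, hT, -⟩ := h
  obtain ⟨h1, h2⟩ := mulLeft_mul_opT_iff.1 hT
  have h1' : φ.g = ψ.g * u ^ (Fintype.card k - 1) := by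
    rw [pow_card_eq (k := k)] at h1
    exact mul_left_cancel₀ hu (by linear_combination h1)
  have h2' : φ.Δ = ψ.Δ * (u ^ (Fintype.card k - 1)) ^ (Fintype.card k + 1) := by
    rw [← pow_card_sub_one_pow (k := k)] at h2
    exact mul_left_cancel₀ hu (by linear_combination h2)
  have hu' : u ^ (Fintype.card k - 1) ≠ 0 := pow_ne_zero _ hu
  have := ψ.Δ_ne_zero
  rw [DrinfeldModule.J, DrinfeldModule.J, h1', h2', mul_pow]
  field_simp

theorem J_tMod {k Ω : Type*} [Fintype k] [Field Ω] (x : Ω) : (tMod k x).J k = -(tMod k x).g ^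
    (Fintype.card k + 1) := by
  simp [DrinfeldModule.J, tMod, div_neg]

theorem one_lt_valuation_g {k Ω : Type*} [Field k] [Fintype k] [Field Ω] {Γ : Type*}
    [LinearOrderedCommGroupWithZero Γ] {v : Valuation Ω Γ}
    {x : Ω} (h : 1 < v x) : 1 < v (tMod k x).g := by
  have hq := Fintype.one_lt_card (α := k)
  have hlt : v x < v (x ^ (Fintype.card k ^ 2)) := by
    rw [map_pow]
    exact lt_self_pow₀ h (Nat.one_lt_pow (by norm_num) hq)
  simp only [tMod]
  rw [map_div₀, v.map_sub_eq_of_lt_left hlt, map_pow, map_pow,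
    one_lt_div₀ (pow_pos (zero_lt_one.trans h) _)]
  exact pow_lt_pow_right₀ h (by nlinarith)

/-- `g` behaves like `x^(q²-q)` at a pole of `x`, so `J` has a pole there. -/
theorem transcendental_J {k K Ω : Type*} [Field k] [Fintype k] [Field K] [Field Ω]
    [Algebra K Ω] {x : Ω} (ht : Transcendental K x) :
    Transcendental K ((tMod k x).J k) := by
  obtain ⟨V, hV, h0⟩ := exists_valuation_one_lt ht
  have h1 : 1 < V.valuation ((tMod k x).J k) := by
    rw [J_tMod, Valuation.map_neg, map_pow]
    exact one_lt_pow₀ (one_lt_valuation_g h0) (Nat.succ_ne_zero _)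
  refine V.valuation.transcendental_of_ne_one K _ (fun h => ?_) h1.ne'
  rw [h, map_zero] at h1
  exact not_lt_zero h1

theorem g_ne_zero_of_transcendental {k K Ω : Type*} [Field k] [Fintype k] [Field K] [Field Ω]
    [Algebra K Ω] {x : Ω} (ht : Transcendental K x) : (tMod k x).g ≠ 0 := by
  intro h
  refine transcendental_J (k := k) ht ?_
  rw [J_tMod, h, zero_pow (Nat.succ_ne_zero _), neg_zero]
  exact isAlgebraic_zero

theorem mem_separableClosure_of_mem {F : IntermediateField K Ω} {a : Ω} (ha : a ∈ F) :
    a ∈ separableClosure F Ω :=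
  (separableClosure F Ω).algebraMap_mem ⟨a, ha⟩

variable [IsAlgClosed Ω] {n : ℕ} [NeZero n] {x : Fin n → Ω}

theorem isogCoeffs_levelGroup_subset_iff {y : Fin n → Ω} (hx : IsPoint k x) (hy : IsPoint k y)
    {τ : coordField K x →ₐ[K] Ω} (hτ : ∀ i, τ (coordGen K x i) = y i) :
    isogCoeffs (levelGroup k x) ⊆ (embFixed τ : Set Ω) ↔ levelGroup k y = levelGroup k x := by
  have := isogCoeffs_subset_embFixed_iff hx hy hτ one_ne_zero one_ne_zero (v := 1) (by simp)
    (by simp)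
  rwa [map_mulLeft_one, map_mulLeft_one] at this

/-- The field of coordinates is the field of definition of the generic triple. -/
theorem IsPoint.coordField_eq (hx : IsPoint k x) :
    coordField K x = fieldX0DotPrime K (tMod k (x 0)) (x 0) (levelGroup k x) := by
  -- An embedding fixing the generators sends `x` to a point with the same triple, which is `x`
  -- itself by uniqueness.
  have hle : ∀ {y : Fin n → Ω} {τ : coordField K x →ₐ[K] Ω} (_ : IsPoint k y)
      (_ : ∀ i, τ (coordGen K x i) = y i),
      fieldX0DotPrime K (tMod k (x 0)) (x 0) (levelGroup k x) ≤ embFixed τ ↔ y = x := by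
    intro y τ hy hτ
    rw [fieldX0DotPrime, adjoin_le_iff, Set.union_subset_iff,
      isogCoeffs_levelGroup_subset_iff hx hy hτ, Set.insert_subset_iff,
      Set.singleton_subset_iff, SetLike.mem_coe, SetLike.mem_coe, g_mem_embFixed_iff hτ,
      coord_mem_embFixed_iff hτ]
    constructor
    · rintro ⟨⟨-, h0⟩, hG⟩
      obtain ⟨hlev, hmem, hT, -⟩ := hx.triple
      exact (existsUnique_isPoint (φ := tMod k (x 0)) rfl hlev (hx.1 0) hmem hT).unique
        ⟨hy, h0, by rw [h0], hG⟩ ⟨hx, rfl, rfl, rfl⟩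
    · rintro rfl
      exact ⟨⟨rfl, rfl⟩, rfl⟩
  have hFL : fieldX0DotPrime K (tMod k (x 0)) (x 0) (levelGroup k x) ≤ coordField K x :=
    ((hle (τ := (coordField K x).val) hx fun i => rfl).2 rfl).trans (embFixed_le _)
  refine le_antisymm (fun w hw => ?_) hFL
  refine mem_of_forall_embedding_eq hFL (hx.isSeparable (mem_separableClosure_of_mem
    (subset_adjoin _ _ (Or.inl (Or.inr rfl))))) hw fun τ hτ => ?_
  have h := (hle (hx.image τ) fun i => rfl).1 fun a ha => ⟨hFL ha, hτ a ha⟩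
  have : τ = (coordField K x).val := coordField_algHom_ext fun i => congrFun h i
  rw [this]
  rfl

/-- The quotient by `kˣ`. -/
theorem IsPoint.fixedBy_units_eq [IsScalarTower k k₁ Ω] (hx : IsPoint k x)
    {σ : k₁ˣ →* (coordField K x ≃ₐ[K] coordField K x)}
    (hσ : ∀ c i, (σ c (coordGen K x i) : Ω) = act k c x i) :
    fixedBy (σ.comp (Units.map (algebraMap k k₁).toMonoidHom)).range =
      fieldX0Dot K (tMod k (x 0)) (levelGroup k x) := by
  have hle : ∀ {y : Fin n → Ω} {τ : coordField K x →ₐ[K] Ω} (_ : IsPoint k y)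
      (_ : ∀ i, τ (coordGen K x i) = y i),
      fieldX0Dot K (tMod k (x 0)) (levelGroup k x) ≤ embFixed τ ↔
        (tMod k (y 0)).g = (tMod k (x 0)).g ∧ levelGroup k y = levelGroup k x := by
    intro y τ hy hτ
    rw [fieldX0Dot, adjoin_le_iff, Set.union_subset_iff,
      isogCoeffs_levelGroup_subset_iff hx hy hτ, Set.singleton_subset_iff, SetLike.mem_coe,
      g_mem_embFixed_iff hτ]
  refine fixedBy_eq_of_embFixed (hx.isSeparable (mem_separableClosure_of_g (k := k) (hx.1 0)
    (mem_separableClosure_of_mem (subset_adjoin _ _ (Or.inl rfl))))) ?_ fun τ hτ => ?_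
  · rintro _ ⟨c, rfl⟩
    obtain ⟨h1, h2⟩ := pair_act_algebraMap (k₁ := k₁) hx c
    refine (hle (y := act k (Units.map (algebraMap k k₁).toMonoidHom c) x) ?_
      fun i => hσ _ i).2 ⟨congrArg _ h1, h2⟩
    have : (fun i => ((coordField K x).val.comp
      (σ (Units.map (algebraMap k k₁).toMonoidHom c)).toAlgHom) (coordGen K x i)) =
        act k (Units.map (algebraMap k k₁).toMonoidHom c) x :=
      funext fun i => hσ _ i
    rw [← this]
    exact hx.image _
  · obtain ⟨h1, h2⟩ := (hle (hx.image τ) fun i => rfl).1 hτ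
    obtain ⟨c, hc⟩ := hx.exists_act_of_pair_eq (k₁ := k₁) (hx.image τ)
      (tMod_eq_iff.2 h1).symm h2.symm
    exact ⟨_, ⟨c, rfl⟩, algHom_eq_val_comp hσ fun i => congrFun hc i⟩

/-- If `u` is an isomorphism onto a model `φ` defined over `K(J)`, an embedding fixes the function
field of `X₀` computed from `φ` if and only if it preserves the isomorphism class. -/
theorem IsPoint.fieldX0_le_embFixed_iff {y : Fin n → Ω} (hx : IsPoint k x)
    (hy : IsPoint k y) {τ : coordField K x →ₐ[K] Ω} (hτ : ∀ i, τ (coordGen K x i) = y i)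
    {φ : DrinfeldModule Ω} {G : Submodule k Ω} (hφ : IsGenericModel K k φ) {u : Ω}
    (hu : IsIso k u (tMod k (x 0)) (levelGroup k x) φ G) :
    fieldX0 K φ G ≤ embFixed τ ↔
      ∃ u', IsIso k u' (tMod k (y 0)) (levelGroup k y) φ G := by
  have : Infinite Ω := IsAlgClosed.instInfinite
  have hq := Fintype.one_lt_card (α := k)
  have hJ : φ.J k ∈ embFixed τ ↔ (tMod k (y 0)).J k = φ.J k := by
    have h1 : φ.J k =
        ((-(tMod k (coordGen K x 0)).g ^ (Fintype.card k + 1) : coordField K x) : Ω) := by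
      rw [← hu.J_eq, J_tMod]
      push_cast
      rw [← show ((tMod k (coordGen K x 0)).g : Ω) = (tMod k (x 0)).g from
        map_tMod_g (k := k) (coordField K x).val.toRingHom (coordGen K x 0)]
    have h2 : τ (-(tMod k (coordGen K x 0)).g ^ (Fintype.card k + 1)) = (tMod k (y 0)).J k := by
      rw [J_tMod, map_neg, map_pow, ← hτ 0]
      rw [show τ (tMod k (coordGen K x 0)).g = (tMod k (τ (coordGen K x 0))).g from
        map_tMod_g (k := k) τ.toRingHom (coordGen K x 0)]
    rw [h1, coe_mem_embFixed, h2]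
  have hφg : φ.g ≠ 0 := by
    intro h
    refine hφ.1 ?_
    rw [DrinfeldModule.J, h, zero_pow (Nat.succ_ne_zero _), zero_div]
    exact isAlgebraic_zero
  obtain ⟨hu0, hT, rfl⟩ := hu
  obtain ⟨hg, hΔ⟩ := mulLeft_mul_opT_iff.1 hT
  -- Once `τ` fixes `J`, it fixes `K(J)` and hence both coefficients of `φ`.
  have hiff : φ.J k ∈ embFixed τ → (isogCoeffs ((levelGroup k x).map (LinearMap.mulLeft k u)) ⊆
      (embFixed τ : Set Ω) ↔ ∃ u', IsIso k u' (tMod k (y 0)) (levelGroup k y) φ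
        ((levelGroup k x).map (LinearMap.mulLeft k u))) := by
    intro hJτ
    have hK : K⟮φ.J k⟯ ≤ embFixed τ := adjoin_simple_le_iff.2 hJτ
    obtain ⟨hgL, hgτ⟩ := hK hφ.2.1
    obtain ⟨hΔL, hΔτ⟩ := hK hφ.2.2
    set gL : coordField K x := ⟨φ.g, hgL⟩ with hgLdef
    set ΔL : coordField K x := ⟨φ.Δ, hΔL⟩ with hΔLdef
    -- This is `u^(q-1)`, read off from the coefficients of `τ`; the division is legitimate since
    -- transcendence of `J` gives `φ.g ≠ 0`.
    set v : coordField K x := (tMod k (coordGen K x 0)).g / gL with hvdef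
    have hv : (v : Ω) = u ^ (Fintype.card k - 1) := by
      have h1 : (v : Ω) = (tMod k (x 0)).g / φ.g := by
        rw [← show ((tMod k (coordGen K x 0)).g : Ω) = (tMod k (x 0)).g from
          map_tMod_g (k := k) (coordField K x).val.toRingHom (coordGen K x 0)]
        rfl
      rw [h1, div_eq_iff hφg]
      rw [pow_card_eq (k := k)] at hg
      exact mul_left_cancel₀ hu0 (by linear_combination hg)
    have hvτ : τ v = (tMod k (y 0)).g / φ.g := by
      rw [hvdef, map_div₀, hgτ, ← hτ 0]
      rw [show τ (tMod k (coordGen K x 0)).g = (tMod k (τ (coordGen K x 0))).g from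
        map_tMod_g (k := k) τ.toRingHom (coordGen K x 0)]
    have hv0 : τ v ≠ 0 := by
      rw [Ne, map_eq_zero]
      intro h
      rw [h] at hv
      exact pow_ne_zero _ hu0 hv.symm
    have hvΔ : ΔL * v ^ (Fintype.card k + 1) = -1 := by
      refine Subtype.ext ?_
      push_cast
      rw [hv]
      rw [← pow_card_sub_one_pow (k := k)] at hΔ
      refine mul_left_cancel₀ hu0 ?_
      rw [hΔLdef]
      simp only [tMod] at hΔ
      linear_combination -hΔ
    have hvΔτ : φ.Δ * τ v ^ (Fintype.card k + 1) = -1 := by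
      have := congrArg τ hvΔ
      rwa [map_mul, map_pow, hΔτ, map_neg, map_one] at this
    constructor
    · intro h
      -- Any such root is an isomorphism `t_{y_0} → φ`: the formulas `hvτ` and `hvΔτ` are the
      -- required conditions on `g` and `Δ`.
      obtain ⟨u', hu'⟩ := IsAlgClosed.exists_pow_nat_eq (τ v)
        (n := Fintype.card k - 1) (by omega)
      have hu'0 : u' ≠ 0 := by
        rintro rfl
        rw [zero_pow (by omega)] at hu'
        exact hv0 hu'.symm
      refine ⟨u', hu'0, mulLeft_mul_opT_iff.2 ⟨?_, ?_⟩,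
        (isogCoeffs_subset_embFixed_iff hx hy hτ hu0 hu'0 hv hu'.symm).1 h⟩
      · rw [pow_card_eq (k := k), hu', hvτ]
        field_simp
      · rw [← pow_card_sub_one_pow (k := k), hu']
        simp only [tMod]
        linear_combination -u' * hvΔτ
    · rintro ⟨u', hu'0, hT', hG'⟩
      refine (isogCoeffs_subset_embFixed_iff hx hy hτ hu0 hu'0 hv ?_).2 hG'
      have := (mulLeft_mul_opT_iff.1 hT').1
      rw [pow_card_eq (k := k)] at this
      rw [hvτ, div_eq_iff hφg]
      exact mul_left_cancel₀ hu'0 (by linear_combination this)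
  rw [fieldX0, adjoin_le_iff, Set.union_subset_iff, Set.singleton_subset_iff, SetLike.mem_coe]
  constructor
  · rintro ⟨h1, h2⟩
    exact (hiff h1).1 h2
  · rintro ⟨u', hu'⟩
    have h1 := hJ.2 hu'.J_eq
    exact ⟨h1, (hiff h1).2 ⟨u', hu'⟩⟩

end GenericPoint

/-! ### The quotients by `kˣ` and `k₁ˣ` -/

section Quotients

variable {k k₁ K Ω : Type*} [Field k] [Fintype k] [Field k₁] [Field K] [Field Ω] [IsAlgClosed Ω]
  [Algebra k k₁] [Algebra K Ω] [Algebra k₁ Ω] [Algebra k Ω]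
  {n : ℕ} [NeZero n] {x : Fin n → Ω} {σ : k₁ˣ →* (coordField K x ≃ₐ[K] coordField K x)}

theorem IsPoint.eq_val_comp_of_fieldX0_le (hk₁ : Module.finrank k k₁ = 2) (hx : IsPoint k x)
    {φ : DrinfeldModule Ω} {G : Submodule k Ω} (hφ : IsGenericModel K k φ) {u : Ω}
    (hu : IsIso k u (tMod k (x 0)) (levelGroup k x) φ G) {τ : coordField K x →ₐ[K] Ω}
    (hτ : fieldX0 K φ G ≤ embFixed τ) :
    ∃ c : k₁ˣ, (fun i => τ (coordGen K x i)) = act k c x := by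
  obtain ⟨u', hu'⟩ := (hx.fieldX0_le_embFixed_iff (hx.image τ) (fun i => rfl) hφ hu).1 hτ
  exact hx.exists_act_of_isIso hk₁ (hx.image τ) (hu.trans hu'.symm)

/-- The quotient by `k₁ˣ`. -/
theorem IsPoint.fixedBy_range_eq (hk₁ : Module.finrank k k₁ = 2) (hx : IsPoint k x)
    (hσ : ∀ c i, (σ c (coordGen K x i) : Ω) = act k c x i)
    {φ : DrinfeldModule Ω} {G : Submodule k Ω} (hφ : IsGenericModel K k φ) {u : Ω}
    (hu : IsIso k u (tMod k (x 0)) (levelGroup k x) φ G) :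
    fixedBy σ.range = fieldX0 K φ G := by
  have : Infinite Ω := IsAlgClosed.instInfinite
  have hJ : (tMod k (x 0)).J k ∈ fieldX0 K φ G := by
    rw [hu.J_eq]
    exact subset_adjoin _ _ (Or.inl rfl)
  have hg : (tMod k (x 0)).g ∈ separableClosure (fieldX0 K φ G) Ω := by
    have hne : (tMod k (x 0)).g ≠ 0 := fun h => hφ.1 (by
      rw [← hu.J_eq, J_tMod, h, zero_pow (Nat.succ_ne_zero _), neg_zero]
      exact isAlgebraic_zero)
    refine mem_separableClosure_of_pow (k := k) hne (mem_separableClosure_of_mem ?_)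
    rw [← neg_neg (_ ^ _), ← J_tMod]
    exact neg_mem hJ
  refine fixedBy_eq_of_embFixed (hx.isSeparable (mem_separableClosure_of_g (k := k) (hx.1 0) hg))
    ?_ fun τ hτ => ?_
  · rintro _ ⟨c, rfl⟩
    exact (hx.fieldX0_le_embFixed_iff (hx.isPoint_act hk₁ c) (fun i => hσ c i) hφ hu).2
      ⟨_, (hx.isIso_act hk₁ c).symm.trans hu⟩
  · obtain ⟨c, hc⟩ := hx.eq_val_comp_of_fieldX0_le hk₁ hφ hu hτ
    exact ⟨_, ⟨c, rfl⟩, algHom_eq_val_comp hσ fun i => congrFun hc i⟩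

/-- A generic point is isomorphic to a module defined over `K(J)`, namely `1 + J τ + J^q τ²`. -/
theorem exists_isGenericModel {x₁ : Ω} (ht : Transcendental K x₁) (G : Submodule k Ω) :
    ∃ (φ : DrinfeldModule Ω) (u : Ω), IsGenericModel K k φ ∧
      IsIso k u (tMod k x₁) G φ (G.map (LinearMap.mulLeft k u)) := by
  have : Infinite Ω := IsAlgClosed.instInfinite
  have hq := Fintype.one_lt_card (α := k)
  set J := (tMod k x₁).J k with hJdef
  have hJ : Transcendental K J := transcendental_J ht
  have hJ0 : J ≠ 0 := fun h => hJ (by rw [h]; exact isAlgebraic_zero)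
  have hg0 : (tMod k x₁).g ≠ 0 := g_ne_zero_of_transcendental ht
  -- The condition on the coefficient of `τ` dictates `u^(q-1) = g / J`; the one on `τ²` then
  -- follows from `g^(q+1) = -J`.
  obtain ⟨u, hu⟩ := IsAlgClosed.exists_pow_nat_eq ((tMod k x₁).g / J)
    (n := Fintype.card k - 1) (by omega)
  have hu0 : u ≠ 0 := by
    rintro rfl
    rw [zero_pow (by omega)] at hu
    exact div_ne_zero hg0 hJ0 hu.symm
  let φ : DrinfeldModule Ω := ⟨J, J ^ Fintype.card k, pow_ne_zero _ hJ0⟩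
  have hφJ : φ.J k = J := by
    simp only [DrinfeldModule.J, φ]
    rw [pow_succ]
    field_simp
  refine ⟨φ, u, ⟨?_, ?_, ?_⟩, hu0, mulLeft_mul_opT_iff.2 ⟨?_, ?_⟩, rfl⟩
  · rwa [hφJ]
  · rw [hφJ]
    exact mem_adjoin_simple_self K J
  · rw [hφJ]
    exact pow_mem (mem_adjoin_simple_self K J) _
  · rw [pow_card_eq (k := k), hu]
    simp only [φ]
    field_simp
  · have hgJ : (tMod k x₁).g ^ (Fintype.card k + 1) = -J := by rw [hJdef, J_tMod, neg_neg]
    rw [← pow_card_sub_one_pow (k := k), hu, div_pow, hgJ, pow_succ J]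
    simp only [φ, tMod]
    field_simp

/-- The field of the quotient by `kˣ` is generated by `g` over that of the quotient by `k₁ˣ`. -/
theorem IsPoint.fixedBy_units_eq_sup [IsScalarTower k k₁ Ω] (hk₁ : Module.finrank k k₁ = 2)
    (hx : IsPoint k x) (ht : Transcendental K (x 0))
    (hσ : ∀ c i, (σ c (coordGen K x i) : Ω) = act k c x i) :
    fixedBy (σ.comp (Units.map (algebraMap k k₁).toMonoidHom)).range =
      fixedBy σ.range ⊔ K⟮(tMod k (x 0)).g⟯ := by
  have hmem : (tMod k (x 0)).g ∈ fixedBy σ.range ⊔ K⟮(tMod k (x 0)).g⟯ :=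
    le_sup_right (a := fixedBy σ.range) (mem_adjoin_simple_self K _)
  refine fixedBy_eq_of_embFixed (hx.isSeparable (mem_separableClosure_of_g (k := k) (hx.1 0)
    (mem_separableClosure_of_mem hmem))) ?_ fun τ hτ => ?_
  · rintro _ ⟨c, rfl⟩
    refine sup_le (fixedBy_le_embFixed ⟨_, rfl⟩) (adjoin_simple_le_iff.2 ?_)
    exact (g_mem_embFixed_iff fun i => hσ _ i).2
      (congrArg DrinfeldModule.g (pair_act_algebraMap (k₁ := k₁) hx c).1)
  · obtain ⟨φ, u, hφ, hu⟩ := exists_isGenericModel ht (levelGroup k x)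
    rw [hx.fixedBy_range_eq hk₁ hσ hφ hu, sup_le_iff, adjoin_simple_le_iff] at hτ
    obtain ⟨c, hc⟩ := hx.eq_val_comp_of_fieldX0_le hk₁ hφ hu hτ.1
    have hg := (g_mem_embFixed_iff (k := k) fun i => congrFun hc i).1 hτ.2
    have hc0 := algebraMap_unit_ne_zero (Ω := Ω) c
    have h1 := tMod_mul_g (k := k) (x := x 0) hc0 (algebraMap_pow_card_sq hk₁ _)
    have h2 : act k c x 0 = algebraMap k₁ Ω c * x 0 := by
      simp [act]
    rw [← h2, hg, mul_comm] at h1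
    -- The twist by `c` multiplies `g` by `c^(1-q)`; as `g ≠ 0` is fixed, `c^q = c` and `c` comes
    -- from `k`.
    have h3 := mul_left_cancel₀ (g_ne_zero_of_transcendental ht) h1
    obtain ⟨d, hd⟩ := exists_algebraMap_eq_of_pow_card h3.symm
    rw [IsScalarTower.algebraMap_apply k k₁ Ω] at hd
    have hd' := (algebraMap k₁ Ω).injective hd
    have hd0 : d ≠ 0 := by
      rintro rfl
      exact c.ne_zero (by rw [← hd', map_zero])
    have hcd : Units.map (algebraMap k k₁).toMonoidHom (Units.mk0 d hd0) = c := Units.ext hd'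
    refine ⟨_, ⟨Units.mk0 d hd0, rfl⟩, ?_⟩
    rw [MonoidHom.comp_apply, hcd]
    exact algHom_eq_val_comp hσ fun i => congrFun hc i

end Quotients

/-! ### The products `z = x_i x_{i+1}` -/

section GarciaStichtenoth

variable {k K Ω : Type*} [Field k] [Fintype k] [Field K] [Field Ω] [Algebra K Ω]

/-- Multiply the step equation by `a^q`. -/
theorem mul_add_mul_pow {a b : Ω} (ha : a ≠ 0)
    (h : (a ^ (Fintype.card k - 1))⁻¹ * b + b ^ Fintype.card k = a) :
    (a * b) ^ Fintype.card k + a * b = a ^ (Fintype.card k + 1) := by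
  have h1 := congrArg (a ^ Fintype.card k * ·) h
  simp only [pow_card_eq (k := k) a] at h1
  have h0 : a ^ (Fintype.card k - 1) ≠ 0 := pow_ne_zero _ ha
  rw [pow_succ, mul_pow, pow_card_eq (k := k) a, ← h1]
  field_simp
  ring

theorem IsPoint.mul_add_mul_pow {n : ℕ} {x : Fin n → Ω} (hx : IsPoint k x) {i j : Fin n}
    (hij : (i : ℕ) + 1 = j) :
    (x i * x j) ^ Fintype.card k + x i * x j = x i ^ (Fintype.card k + 1) :=
  DrinfeldTower.mul_add_mul_pow (hx.1 i) (hx.2 i j hij)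

theorem IsPoint.mul_pow_add_one_ne_zero {n : ℕ} {x : Fin n → Ω} (hx : IsPoint k x) {i j : Fin n}
    (hij : (i : ℕ) + 1 = j) : (x i * x j) ^ (Fintype.card k - 1) + 1 ≠ 0 := by
  intro h
  have h1 := hx.mul_add_mul_pow hij
  rw [pow_card_eq (k := k)] at h1
  refine pow_ne_zero (Fintype.card k + 1) (hx.1 i) ?_
  rw [← h1]
  linear_combination (x i * x j) * h

/-- The recursive equation of the tower of the elements `z`. -/
theorem IsPoint.recursion {n : ℕ} {x : Fin n → Ω} (hx : IsPoint k x) {i j l : Fin n}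
    (hij : (i : ℕ) + 1 = j) (hjl : (j : ℕ) + 1 = l) :
    (x j * x l) ^ Fintype.card k + x j * x l =
      (x i * x j) ^ Fintype.card k / ((x i * x j) ^ (Fintype.card k - 1) + 1) := by
  rw [hx.mul_add_mul_pow hjl, eq_div_iff (hx.mul_pow_add_one_ne_zero hij)]
  have h1 := hx.mul_add_mul_pow hij
  rw [pow_card_eq (k := k)] at h1
  have hi : x i * x j ≠ 0 := mul_ne_zero (hx.1 i) (hx.1 j)
  refine mul_right_cancel₀ hi ?_
  calc x j ^ (Fintype.card k + 1) * ((x i * x j) ^ (Fintype.card k - 1) + 1) * (x i * x j)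
      = x j ^ (Fintype.card k + 1) * x i ^ (Fintype.card k + 1) := by rw [← h1]; ring
    _ = (x i * x j) ^ Fintype.card k * (x i * x j) := by rw [← pow_succ, mul_pow, mul_comm]

theorem zSet_eq_range (x : ℕ → Ω) (m : ℕ) :
    zSet (fun i : Fin (m + 2) => x i) = Set.range fun i : Fin (m + 1) => x i * x (i + 1) := by
  ext z
  constructor
  · rintro ⟨i, j, hij, rfl⟩
    exact ⟨⟨i, by omega⟩, by simp [hij]⟩
  · rintro ⟨i, rfl⟩
    exact ⟨i.castSucc, i.succ, by simp, by simp⟩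

variable [Algebra k Ω]

theorem IsSeq.transcendental_mul {x : ℕ → Ω} (hx : IsSeq k x) (ht : Transcendental K (x 0)) :
    Transcendental K (x 0 * x 1) := by
  obtain ⟨V, hV, h0⟩ := exists_valuation_one_lt ht
  refine V.valuation.transcendental_of_ne_one K _ (mul_ne_zero (hx.1 0) (hx.1 1)) ?_
  rw [map_mul]
  exact (one_lt_mul_of_lt_of_le h0 (hx.valuation_eq h0 1).1.le).ne'

/-- The tower of the elements `z_i = x_i x_{i+1}` has steps of degree `q`. -/
theorem IsSeq.finrank_towerField_mul {x : ℕ → Ω} (hx : IsSeq k x)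
    (ht : Transcendental K (x 0)) (m : ℕ) :
    Module.finrank K⟮x 0 * x 1⟯ (towerField K (fun i => x i * x (i + 1)) m) =
      Fintype.card k ^ m := by
  have hq := Fintype.one_lt_card (α := k)
  obtain ⟨V, hV, h0⟩ := exists_valuation_one_lt ht
  have hv := fun m => hx.valuation_eq h0 m
  refine (DrinfeldTower.finrank_towerField (a := fun i => x i * x (i + 1)) (v := V.valuation) (by omega)
    ?_ (fun m => ?_) (fun m => ?_) m).2
  · rw [map_mul]
    exact one_lt_mul_of_lt_of_le h0 (hv 1).1.le
  -- Total ramification of the coordinates is inherited by the products of neighbours.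
  · rw [map_mul, map_mul, mul_pow, ← (hv m).2, ← (hv (m + 1)).2]
  · set z : towerField K (fun i => x i * x (i + 1)) m := ⟨x m * x (m + 1), mem_towerField _ le_rfl⟩
    refine ⟨X ^ Fintype.card k + (C 1 * X - C (z ^ Fintype.card k /
      (z ^ (Fintype.card k - 1) + 1))), monic_X_pow_add (stepPoly_degree_lt hq _ _), ?_, ?_⟩
    · rw [natDegree_add_eq_left_of_degree_lt, natDegree_X_pow]
      rw [degree_X_pow]
      exact stepPoly_degree_lt hq _ _
    · have := (hx.isPoint (m + 3)).recursion (i := ⟨m, by omega⟩) (j := ⟨m + 1, by omega⟩)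
        (l := ⟨m + 2, by omega⟩) rfl rfl
      simp only [map_add, map_sub, map_pow, aeval_X, aeval_C, map_one, one_mul]
      rw [← add_sub_assoc, this, sub_eq_zero, map_div₀, map_add, map_pow, map_pow, map_one]
      rfl

end GarciaStichtenoth

/-! ### The quotient by the elements of norm one -/

section NormOne

variable {k k₁ K Ω : Type*} [Field k] [Fintype k] [Field k₁] [Field K] [Field Ω] [IsAlgClosed Ω]
  [Algebra k k₁] [Algebra K Ω] [Algebra k₁ Ω] [Algebra k Ω]

theorem pow_card_sq_of_pow_eq_one {k Ω : Type*} [Field k] [Fintype k] [Field Ω] {c : Ω}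
    (h : c ^ (Fintype.card k + 1) = 1) :
    c ^ (Fintype.card k ^ 2) = c := by
  rw [← pow_card_sub_one_pow (k := k), ← pow_mul, mul_comm (_ - 1), pow_mul, h, one_pow, one_mul]

theorem pow_card_pow_succ_mul {k Ω : Type*} [Fintype k] [Field Ω] {c : Ω}
    (h : c ^ (Fintype.card k + 1) = 1) (i : ℕ) :
    c ^ (Fintype.card k ^ i) * c ^ (Fintype.card k ^ (i + 1)) = 1 := by
  rw [pow_succ, pow_mul, ← pow_succ', ← pow_mul, mul_comm, pow_mul, h, one_pow]

/-- The quotient by the elements of norm one. -/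
theorem IsPoint.fixedBy_normOne_eq (hk₁ : Module.finrank k k₁ = 2) {n : ℕ} [NeZero n]
    {x : Fin n → Ω} (hn : 2 ≤ n) (hx : IsPoint k x)
    {σ : k₁ˣ →* (coordField K x ≃ₐ[K] coordField K x)}
    (hσ : ∀ c i, (σ c (coordGen K x i) : Ω) = act k c x i) :
    fixedBy ((powMonoidHom (Fintype.card k + 1) : k₁ˣ →* k₁ˣ).ker.map σ) =
      adjoin K (zSet x) := by
  have hle : ∀ {y : Fin n → Ω} {τ : coordField K x →ₐ[K] Ω}
      (_ : ∀ i, τ (coordGen K x i) = y i), adjoin K (zSet x) ≤ embFixed τ ↔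
        ∀ i j : Fin n, (i : ℕ) + 1 = j → y i * y j = x i * x j := by
    intro y τ hτ
    have key : ∀ i j : Fin n, x i * x j ∈ embFixed τ ↔ y i * y j = x i * x j := fun i j => by
      rw [← hτ, ← hτ, ← map_mul]
      exact coe_mem_embFixed (coordGen K x i * coordGen K x j)
    rw [adjoin_le_iff]
    constructor
    · exact fun h i j hij => (key i j).1 (h ⟨i, j, hij, rfl⟩)
    · rintro h _ ⟨i, j, hij, rfl⟩
      exact (key i j).2 (h i j hij)
  have h01 : ((0 : Fin n) : ℕ) + 1 = ((⟨1, hn⟩ : Fin n) : ℕ) := rfl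
  have hx0 : x 0 ∈ separableClosure (adjoin K (zSet x)) Ω := by
    refine mem_separableClosure_of_pow (k := k) (hx.1 0) (mem_separableClosure_of_mem ?_)
    rw [← hx.mul_add_mul_pow h01]
    have hz : x 0 * x ⟨1, hn⟩ ∈ adjoin K (zSet x) := subset_adjoin _ _ ⟨_, _, h01, rfl⟩
    exact add_mem (pow_mem hz _) hz
  refine fixedBy_eq_of_embFixed (hx.isSeparable hx0) ?_ fun τ hτ => ?_
  · rintro _ ⟨c, hc, rfl⟩
    refine (hle fun i => hσ c i).2 fun i j hij => ?_
    have hc' : algebraMap k₁ Ω c ^ (Fintype.card k + 1) = 1 := by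
      have : c ^ (Fintype.card k + 1) = 1 := hc
      rw [← map_pow, ← Units.val_pow_eq_pow_val, this, Units.val_one, map_one]
    have := pow_card_pow_succ_mul (k := k) hc' i
    rw [act, act, ← hij]
    linear_combination (x i * x j) * this
  · set y : Fin n → Ω := fun i => τ (coordGen K x i) with hydef
    have hy : IsPoint k y := hx.image τ
    have hz := (hle (y := y) fun i => rfl).1 hτ
    -- Both sides are `z^q + z` for the common first product `z`; so `y 0 / x 0` has norm one, and
    -- the remaining products determine every later coordinate in turn.
    have h0 : y 0 ^ (Fintype.card k + 1) = x 0 ^ (Fintype.card k + 1) := by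
      rw [← hx.mul_add_mul_pow h01, ← hy.mul_add_mul_pow h01, hz _ _ h01]
    have hc1 : (y 0 / x 0) ^ (Fintype.card k + 1) = 1 := by
      rw [div_pow, h0, div_self (pow_ne_zero _ (hx.1 0))]
    obtain ⟨c, hc⟩ := exists_unit_algebraMap_eq hk₁ (div_ne_zero (hy.1 0) (hx.1 0))
      (pow_card_sq_of_pow_eq_one (k := k) hc1)
    rw [← hc] at hc1
    have hck : c ^ (Fintype.card k + 1) = 1 := by
      refine Units.ext ((algebraMap k₁ Ω).injective ?_)
      rw [Units.val_pow_eq_pow_val, map_pow, hc1, Units.val_one, map_one]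
    have hact : ∀ (i : ℕ) (hi : i < n), y ⟨i, hi⟩ = act k c x ⟨i, hi⟩ := by
      intro i
      induction i with
      | zero =>
        intro hi
        simp only [act, pow_zero, pow_one, hc]
        exact (div_mul_cancel₀ (y 0) (hx.1 0)).symm
      | succ i ih =>
        intro hi
        have h1 := hz ⟨i, by omega⟩ ⟨i + 1, hi⟩ rfl
        refine mul_left_cancel₀ (hy.1 ⟨i, by omega⟩) ?_
        rw [h1, ih, act, act]
        linear_combination (-(x ⟨i, by omega⟩ * x ⟨i + 1, hi⟩)) *
          pow_card_pow_succ_mul (k := k) hc1 i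
    exact ⟨_, ⟨c, hck, rfl⟩, algHom_eq_val_comp hσ fun i => hact i i.2⟩

end NormOne

end

end DrinfeldTower

/-! ### Assembly of the theorem -/

open DrinfeldTower in
theorem mainTheorem3
    {k k₁ K Ω : Type*} [Field k] [Fintype k] [Field k₁] [Field K] [Field Ω] [IsAlgClosed Ω]
    [Algebra k k₁] [Algebra k₁ K] [Algebra K Ω] [Algebra k₁ Ω] [Algebra k Ω]
    [IsScalarTower k₁ K Ω] [IsScalarTower k k₁ Ω]
    (hk₁ : Module.finrank k k₁ = 2) (n : ℕ) [NeZero n] :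
    -- the formula defines a group action on the points of the curve
    ((∀ x : Fin n → Ω, IsPoint k x →
        (∀ c : k₁ˣ, IsPoint k (act k c x)) ∧ act k (1 : k₁ˣ) x = x ∧
        ∀ c d : k₁ˣ, act k (c * d) x = act k c (act k d x)) ∧
    -- points `(x₁, …, xₙ)` correspond to triples (normalized `φ`, `x₁`, `G`)
      (∀ x : Fin n → Ω, IsPoint k x →
        IsLevel k (tMod k (x 0)) n (levelGroup k x) ∧
        x 0 ∈ levelGroup k x ∧ (tMod k (x 0)).opT k (x 0) = 0 ∧
        ∀ (m : ℕ) (hm : m ≤ n), levelGroup k (fun i : Fin m => x (Fin.castLE hm i)) =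
          (levelGroup k x).map ((tMod k (x 0)).opT k ^ (n - m))) ∧
      (∀ (φ : DrinfeldModule Ω) (x₁ : Ω) (G : Submodule k Ω), φ.IsNormalized →
        IsLevel k φ n G → x₁ ≠ 0 → x₁ ∈ G → φ.opT k x₁ = 0 →
        ∃! x : Fin n → Ω, IsPoint k x ∧ x 0 = x₁ ∧ tMod k (x 0) = φ ∧ levelGroup k x = G) ∧
    -- orbits of `kˣ` correspond to pairs (normalized `φ`, `G`)
      (∀ (φ : DrinfeldModule Ω) (G : Submodule k Ω), φ.IsNormalized → IsLevel k φ n G →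
        ∃ x : Fin n → Ω, IsPoint k x ∧ tMod k (x 0) = φ ∧ levelGroup k x = G) ∧
      (∀ x y : Fin n → Ω, IsPoint k x → IsPoint k y →
        ((tMod k (x 0) = tMod k (y 0) ∧ levelGroup k x = levelGroup k y) ↔
          ∃ c : kˣ, y = act k (Units.map (algebraMap k k₁).toMonoidHom c) x)) ∧
    -- orbits of `k₁ˣ` correspond to isomorphism classes of pairs (`φ`, `G`)
      (∀ (φ : DrinfeldModule Ω) (G : Submodule k Ω), IsLevel k φ n G →
        ∃ x : Fin n → Ω, IsPoint k x ∧
          ∃ u : Ω, IsIso k u (tMod k (x 0)) (levelGroup k x) φ G) ∧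
      (∀ x : Fin n → Ω, IsPoint k x → ∀ c : k₁ˣ,
        IsIso k (algebraMap k₁ Ω c) (tMod k (x 0)) (levelGroup k x)
          (tMod k (act k c x 0)) (levelGroup k (act k c x))) ∧
      (∀ x y : Fin n → Ω, IsPoint k x → IsPoint k y →
        ((∃ u : Ω, IsIso k u (tMod k (x 0)) (levelGroup k x)
            (tMod k (y 0)) (levelGroup k y)) ↔
          ∃ c : k₁ˣ, y = act k c x))) ∧
    -- function fields, at a generic point `x`
    (∀ x : Fin n → Ω, IsPoint k x → Transcendental K (x 0) →
      coordField K x = fieldX0DotPrime K (tMod k (x 0)) (x 0) (levelGroup k x) ∧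
      Module.finrank (IntermediateField.adjoin K {x 0})
        (IntermediateField.adjoin (IntermediateField.adjoin K {x 0}) (Set.range x)) =
          Fintype.card k ^ (n - 1) ∧
      ∃ σ : k₁ˣ →* (coordField K x ≃ₐ[K] coordField K x),
        Function.Injective σ ∧
        (∀ (c : k₁ˣ) (i : Fin n) (w : coordField K x), (w : Ω) = x i →
          (σ c w : Ω) = act k c x i) ∧
        -- the quotient by `kˣ`
        fixedBy (σ.comp (Units.map (algebraMap k k₁).toMonoidHom)).range =
          fieldX0Dot K (tMod k (x 0)) (levelGroup k x) ∧
        fixedBy (σ.comp (Units.map (algebraMap k k₁).toMonoidHom)).range =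
          fixedBy σ.range ⊔ IntermediateField.adjoin K {(tMod k (x 0)).g} ∧
        (tMod k (x 0)).g ^ (Fintype.card k + 1) = -(tMod k (x 0)).J k ∧
        -- the quotient by `k₁ˣ`
        (∀ (φ : DrinfeldModule Ω) (G : Submodule k Ω), IsGenericModel K k φ →
          (∃ u : Ω, IsIso k u (tMod k (x 0)) (levelGroup k x) φ G) →
          fixedBy σ.range = fieldX0 K φ G) ∧
        -- the quotient by the elements of norm one, and its recursive equation
        ((∀ h : 2 ≤ n,
          fixedBy ((powMonoidHom (Fintype.card k + 1) : k₁ˣ →* k₁ˣ).ker.map σ) =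
            IntermediateField.adjoin K (zSet x) ∧
          Transcendental K (x 0 * x ⟨1, h⟩) ∧
          Module.finrank (IntermediateField.adjoin K {x 0 * x ⟨1, h⟩})
            (IntermediateField.adjoin (IntermediateField.adjoin K {x 0 * x ⟨1, h⟩}) (zSet x)) =
              Fintype.card k ^ (n - 2)) ∧
        ∀ i j l : Fin n, (i : ℕ) + 1 = j → (j : ℕ) + 1 = l →
          (x i * x j) ^ (Fintype.card k - 1) + 1 ≠ 0 ∧
          (x j * x l) ^ Fintype.card k + x j * x l =
            (x i * x j) ^ Fintype.card k / ((x i * x j) ^ (Fintype.card k - 1) + 1))) := by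
  refine ⟨moduli_points hk₁ n, fun x hx ht => ⟨hx.coordField_eq, ?_, ?_⟩⟩
  · obtain ⟨m, rfl⟩ := Nat.exists_eq_succ_of_ne_zero (NeZero.ne n)
    obtain ⟨x, hs, rfl⟩ := exists_isSeq hx
    exact hs.finrank_towerField ht m
  obtain ⟨σ, hσ⟩ := hx.exists_action (K := K) hk₁ ht
  refine ⟨σ, ?_, fun c i w hw => ?_, hx.fixedBy_units_eq hσ,
    hx.fixedBy_units_eq_sup hk₁ ht hσ, ?_, ?_, fun h => ⟨hx.fixedBy_normOne_eq hk₁ h hσ, ?_⟩,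
    fun i j l hij hjl => ⟨hx.mul_pow_add_one_ne_zero hij, hx.recursion hij hjl⟩⟩
  · refine (injective_iff_map_eq_one σ).2 fun c hc => ?_
    have h := hσ c 0
    rw [hc] at h
    have h' : x 0 = algebraMap k₁ Ω c * x 0 := by
      simpa [act, coordGen] using h
    refine Units.ext ((algebraMap k₁ Ω).injective ?_)
    rw [Units.val_one, map_one]
    exact mul_right_cancel₀ (hx.1 0) (by rw [one_mul, ← h'])
  · obtain rfl : w = coordGen K x i := Subtype.ext hw
    exact hσ c i
  · rw [J_tMod, neg_neg]
  · rintro φ G hφ ⟨u, hu⟩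
    exact hx.fixedBy_range_eq hk₁ hσ hφ hu
  -- With `m + 2` coordinates there are `m + 1` products, hence `m` steps above the first.
  · obtain ⟨m, rfl⟩ : ∃ m, n = m + 2 := ⟨n - 2, by omega⟩
    obtain ⟨x, hs, rfl⟩ := exists_isSeq hx
    refine ⟨hs.transcendental_mul ht, ?_⟩
    rw [zSet_eq_range]
    exact hs.finrank_towerField_mul ht m
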